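/- Let $\mathcal G_\bullet$ be the set of isomorphism classes of rooted graphs $(G,\rho)$, where $G$ is a countable, connected, locally finite simple graph and $\rho$ a vertex of $G$, with the local distance $$d_{\mathrm{loc}}((G_1,\rho_1),(G_2,\rho_2))=\inf\Big\{\tfrac1{r+1}: r\ge 0,\ (B_{G_1}(\rho_1,r),\rho_1)\simeq(B_{G_2}(\rho_2,r),\rho_2)\Big\},$$ where $B_G(\rho,r)$ is the subgraph induced by the vertices at graph distance at most $r$ from $\rho$, and with its Borel $\sigma$-algebra. Let $\vec{\mathcal G}$ be the analogous space of isomorphism classes of graphs with a semi-infinite path $(G,(x_n)_{n\ge0})$, two of which agree up to level $r$ if the balls of radius $r$ around the starting points are isomorphic by an isomorphism that maps the first path to the second up to time $r$. Let $\theta(G,(x_n)_{n\ge0})=(G,(x_{n+1})_{n\ge0})$ be the shift. Let $(G,\rho)$ be a random rooted graph with law $\mathbf P$ on $\mathcal G_\bullet$; conditionally on $(G,\rho)$, let $(X_n)_{n\ge0}$ be the simple random walk on $G$ started at $\rho$ (on the one-vertex graph the walk stays put), and let $\mathbb P$ be the law of $(G,(X_n)_{n\ge0})$ on $\vec{\mathcal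 G}$. Assume that $(G,\rho)$ is stationary, that is, $(G,X_n)$ has the same law as $(G,\rho)$ for every $n\ge1$, and ergodic, that is, every $\theta$-invariant event has $\mathbb P$-probability $0$ or $1$. **Theorem 2.2.** Set $R_n=\#\{X_0,\dots,X_n\}$ and $D_n=d^G_{\mathrm{gr}}(X_0,X_n)$, the range of the walk and its graph distance from the root at time $n$. There exists a constant $s\ge0$ such that, almost surely and in $\mathbb L^1$ for $\mathbb P$, $$\frac{R_n}{n}\xrightarrow[n\to\infty]{}\mathbb P\Big(\bigcap_{i\ge1}\{X_i\ne\rho\}\Big),\qquad \frac{D_n}{n}\xrightarrow[n\to\infty]{}s.$$ -/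

import Mathlib

open MeasureTheory ProbabilityTheory Filter Topology

/-- The distance `inf {1 / (r + 1) : a and b agree up to level r}`. -/
noncomputable def levelDist {α : Type*} (R : ℕ → α → α → Prop) (a b : α) : ℝ :=
  sInf {t : ℝ | ∃ r : ℕ, t = 1 / ((r : ℝ) + 1) ∧ R r a b}

/-- A decreasing sequence of equivalence relations, the first of which always holds. -/
structure IsLevels {α : Type*} (R : ℕ → α → α → Prop) : Prop where
  equiv : ∀ r, Equivalence (R r)
  anti : ∀ {r s a b}, r ≤ s → R s a b → R r a b
  zero : ∀ a b, R 0 a b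

namespace IsLevels

variable {α : Type*} {R : ℕ → α → α → Prop}

theorem levelDist_lt (hR : IsLevels R) (a b : α) (t : ℝ) :
    levelDist R a b < t ↔ ∃ r : ℕ, R r a b ∧ 1 / ((r : ℝ) + 1) < t := by
  have hb : BddBelow {t : ℝ | ∃ r : ℕ, t = 1 / ((r : ℝ) + 1) ∧ R r a b} :=
    ⟨0, by rintro _ ⟨r, rfl, -⟩; positivity⟩
  have hne : {t : ℝ | ∃ r : ℕ, t = 1 / ((r : ℝ) + 1) ∧ R r a b}.Nonempty :=
    ⟨_, 0, rfl, hR.zero a b⟩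
  rw [levelDist, csInf_lt_iff hb hne]
  constructor
  · rintro ⟨_, ⟨r, rfl, h⟩, ht⟩
    exact ⟨r, h, ht⟩
  · rintro ⟨r, h, ht⟩
    exact ⟨_, ⟨r, rfl, h⟩, ht⟩

theorem levelDist_nonneg (a b : α) : 0 ≤ levelDist R a b :=
  Real.sInf_nonneg (by rintro _ ⟨r, rfl, -⟩; positivity)

theorem levelDist_comm (hR : IsLevels R) (a b : α) : levelDist R a b = levelDist R b a := by
  have : ∀ r, R r a b ↔ R r b a := fun r => ⟨(hR.equiv r).symm, (hR.equiv r).symm⟩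
  simp only [levelDist, this]

theorem levelDist_triangle (hR : IsLevels R) (a b c : α) :
    levelDist R a c ≤ levelDist R a b + levelDist R b c := by
  refine le_trans (le_of_forall_gt fun t ht => ?_)
    (max_le_add_of_nonneg (levelDist_nonneg a b) (levelDist_nonneg b c))
  obtain ⟨h1, h2⟩ := max_lt_iff.1 ht
  obtain ⟨r, hr, hrt⟩ := (hR.levelDist_lt _ _ _).1 h1
  obtain ⟨s, hs, hst⟩ := (hR.levelDist_lt _ _ _).1 h2
  refine (hR.levelDist_lt _ _ _).2 ⟨min r s, (hR.equiv _).trans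
    (hR.anti (min_le_left _ _) hr) (hR.anti (min_le_right _ _) hs), ?_⟩
  rcases min_choice r s with h | h <;> rwa [h]

/-- The (pseudo)metric space with distance `levelDist R`. -/
noncomputable abbrev pseudoMetric (hR : IsLevels R) : PseudoMetricSpace α where
  dist := levelDist R
  dist_self a := le_antisymm (le_of_forall_gt fun t ht => by
    obtain ⟨n, hn⟩ := exists_nat_one_div_lt ht
    exact (hR.levelDist_lt _ _ _).2 ⟨n, (hR.equiv n).refl a, hn⟩) (levelDist_nonneg a a)
  dist_comm := hR.levelDist_comm
  dist_triangle := hR.levelDist_triangle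

theorem isOpen_iff_level (hR : IsLevels R) (U : Set α) :
    IsOpen[hR.pseudoMetric.toUniformSpace.toTopologicalSpace] U ↔
      ∀ a ∈ U, ∃ r, ∀ b, R r a b → b ∈ U := by
  let := hR.pseudoMetric
  rw [Metric.isOpen_iff]
  refine forall₂_congr fun a ha => ⟨fun ⟨ε, hε, h⟩ => ?_, fun ⟨r, h⟩ => ?_⟩
  · obtain ⟨n, hn⟩ := exists_nat_one_div_lt hε
    exact ⟨n, fun b hb => h ((hR.levelDist_lt b a _).2 ⟨n, (hR.equiv n).symm hb, hn⟩)⟩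
  · refine ⟨1 / ((r : ℝ) + 1), by positivity, fun b hb => ?_⟩
    obtain ⟨s, hs, hsr⟩ := (hR.levelDist_lt b a _).1 hb
    have : r ≤ s := by
      have := (one_div_lt_one_div (by positivity) (by positivity)).1 hsr
      exact_mod_cast (by linarith : (r : ℝ) ≤ s)
    exact h b (hR.anti this ((hR.equiv s).symm hs))

/-- The sets of all points that agree with a given one up to a given level. -/
def cells (R : ℕ → α → α → Prop) : Set (Set α) := {S | ∃ r a, S = {b | R r a b}}

theorem isPiSystem_cells (hR : IsLevels R) : IsPiSystem (cells R) := by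
  have key : ∀ r s a b, r ≤ s → ({c | R r a c} ∩ {c | R s b c}).Nonempty →
      {c | R r a c} ∩ {c | R s b c} = {c | R s b c} := by
    rintro r s a b h ⟨c, hc1, hc2⟩
    refine Set.inter_eq_right.2 fun d hd => ?_
    exact (hR.equiv r).trans hc1 (hR.anti h ((hR.equiv s).trans ((hR.equiv s).symm hc2) hd))
  rintro _ ⟨r, a, rfl⟩ _ ⟨s, b, rfl⟩ hne
  rcases le_total r s with h | h
  · rw [key r s a b h hne]
    exact ⟨s, b, rfl⟩
  · rw [Set.inter_comm] at hne ⊢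
    rw [key s r b a h hne]
    exact ⟨r, a, rfl⟩

theorem borel_eq (hR : IsLevels R) [TopologicalSpace α]
    (hT : ∀ U : Set α, IsOpen U ↔ ∀ a ∈ U, ∃ r, ∀ b, R r a b → b ∈ U)
    (hc : ∀ r, ∃ (β : Type) (_ : Countable β) (f : α → β), ∀ a b, f a = f b → R r a b) :
    borel α = MeasurableSpace.generateFrom (cells R) := by
  have hct : (cells R).Countable := by
    have : cells R = ⋃ r, Set.range fun a => {b | R r a b} := by
      ext S; simp [cells, eq_comm]
    rw [this]
    refine Set.countable_iUnion fun r => ?_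
    obtain ⟨β, _, f, hf⟩ := hc r
    refine (Set.countable_range fun x : Set.range f => {b | R r x.2.choose b}).mono ?_
    rintro _ ⟨a, rfl⟩
    refine ⟨⟨f a, a, rfl⟩, ?_⟩
    have h := hf _ _ (⟨a, rfl⟩ : ∃ y, f y = f a).choose_spec
    ext b
    exact ⟨fun hb => (hR.equiv r).trans ((hR.equiv r).symm h) hb,
      fun hb => (hR.equiv r).trans h hb⟩
  have hb : TopologicalSpace.IsTopologicalBasis (cells R) := by
    refine TopologicalSpace.isTopologicalBasis_of_isOpen_of_nhds ?_ ?_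
    · rintro _ ⟨r, a, rfl⟩
      exact (hT _).2 fun b hb => ⟨r, fun c hc => (hR.equiv r).trans hb hc⟩
    · intro a U ha hU
      obtain ⟨n, hn⟩ := (hT _).1 hU a ha
      exact ⟨_, ⟨n, a, rfl⟩, (hR.equiv n).refl a, hn⟩
  have : SecondCountableTopology α := hb.secondCountableTopology hct
  exact hb.borel_eq_generateFrom

end IsLevels

/-- A countable, connected, locally finite simple graph. -/
structure LFGraph where
  V : Type
  graph : SimpleGraph V
  countable : Countable V
  connected : graph.Connected
  locallyFinite : ∀ v, (graph.neighborSet v).Finite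

namespace LFGraph

/-- The vertex set is a discrete measurable space. -/
instance (G : LFGraph) : MeasurableSpace G.V := ⊤

instance (G : LFGraph) : DiscreteMeasurableSpace G.V := ⟨fun _ => trivial⟩

instance (G : LFGraph) : Countable G.V := G.countable

/-- The possible positions of a simple random walk one step after being at `v`: the neighbours of
`v`. If `v` has no neighbours (by connectedness the graph is then a single vertex), the walk
stays at `v`. -/
def stepSet (G : LFGraph) (v : G.V) : Set G.V :=
  {w | G.graph.Adj v w ∨ (w = v ∧ ∀ u, ¬ G.graph.Adj v u)}

theorem stepSet_finite (G : LFGraph) (v : G.V) : (G.stepSet v).Finite :=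
  ((G.locallyFinite v).union (Set.finite_singleton v)).subset fun _ hw =>
    hw.elim Or.inl fun h => Or.inr h.1

theorem stepSet_nonempty (G : LFGraph) (v : G.V) : (G.stepSet v).Nonempty := by
  by_cases h : ∃ u, G.graph.Adj v u
  · exact ⟨h.choose, Or.inl h.choose_spec⟩
  · exact ⟨v, Or.inr ⟨rfl, not_exists.1 h⟩⟩

/-- The transition kernel of simple random walk: uniform on the neighbours. -/
noncomputable def stepKernel (G : LFGraph) : Kernel G.V G.V where
  toFun v := uniformOn (G.stepSet v)
  measurable' := Measurable.of_discrete

instance (G : LFGraph) : IsMarkovKernel G.stepKernel :=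
  ⟨fun v => isProbabilityMeasure_uniformOn (G.stepSet_finite v) (G.stepSet_nonempty v)⟩

/-- The law of the next position of simple random walk given the positions up to time `n`. -/
noncomputable def walkKernel (G : LFGraph) (n : ℕ) :
    Kernel ((i : Finset.Iic n) → (fun _ : ℕ => G.V) i) G.V :=
  G.stepKernel.comap (fun x => x ⟨n, Finset.mem_Iic.2 le_rfl⟩) (measurable_pi_apply _)

instance (G : LFGraph) (n : ℕ) : IsMarkovKernel (G.walkKernel n) := by
  unfold walkKernel; infer_instance

/-- The law on `V^ℕ` of simple random walk on `G` started at `v`. -/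
noncomputable def walkMeasure (G : LFGraph) (v : G.V) : Measure (ℕ → G.V) :=
  Kernel.traj (X := fun _ => G.V) G.walkKernel 0 fun _ => v

/-- Semi-infinite paths that simple random walk can follow: consecutive vertices are adjacent
(in the one-vertex graph, the constant path). -/
def IsPath (G : LFGraph) (x : ℕ → G.V) : Prop :=
  ∀ n, x (n + 1) ∈ G.stepSet (x n)

/-- The vertices at distance at most `r` from `v`. -/
def ball (G : LFGraph) (v : G.V) (r : ℕ) : Set G.V :=
  {w | G.graph.dist v w ≤ r}

open scoped Classical in
theorem stepKernel_singleton (G : LFGraph) (v w : G.V) :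
    G.stepKernel v {w} = if w ∈ G.stepSet v then ((G.stepSet v).ncard : ENNReal)⁻¹ else 0 := by
  change uniformOn (G.stepSet v) {w} = _
  rw [uniformOn, cond_apply (Set.Finite.measurableSet (G.stepSet_finite v)),
    Measure.count_apply_finite _ (G.stepSet_finite v),
    ← Set.ncard_eq_toFinset_card _ (G.stepSet_finite v)]
  split_ifs with h
  · rw [Set.inter_eq_right.2 (Set.singleton_subset_iff.2 h), Measure.count_singleton, mul_one]
  · rw [Set.inter_singleton_eq_empty.2 h, measure_empty, mul_zero]

/-- The probability that the walk follows a given finite path. -/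
theorem walkMeasure_cylinder (G : LFGraph) (p : ℕ → G.V) (n : ℕ) :
    G.walkMeasure (p 0) {x | ∀ i ≤ n, x i = p i} =
      ∏ i ∈ Finset.range n, G.stepKernel (p i) {p (i + 1)} := by
  let r : (n : ℕ) → (i : Finset.Iic n) → (fun _ : ℕ => G.V) i := fun _ i => p i
  have key : ∀ n, Kernel.partialTraj (X := fun _ => G.V) G.walkKernel 0 n (fun _ => p 0)
      {r n} = ∏ i ∈ Finset.range n, G.stepKernel (p i) {p (i + 1)} := by
    intro n
    induction n with
    | zero =>
      rw [Kernel.partialTraj_self, Kernel.id_apply, Measure.dirac_apply' _ (measurableSet_singleton _)]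
      have : (fun _ => p 0) = r 0 := by
        funext i
        have := Finset.mem_Iic.1 i.2
        change p 0 = p i
        rw [show (i : ℕ) = 0 by omega]
      simp [this]
    | succ n ih =>
      rw [Kernel.partialTraj_succ_of_le (Nat.zero_le n), Kernel.map_apply' _ (by fun_prop) _ (measurableSet_singleton _)]
      let q : (i : Finset.Ioc n (n + 1)) → (fun _ : ℕ => G.V) i := fun i => p i
      have : IicProdIoc (X := fun _ => G.V) n (n+1) ⁻¹' {r (n+1)} =
         {r n} ×ˢ {q} := by
        ext ⟨x, y⟩
        simp only [Set.mem_preimage, Set.mem_singleton_iff, Set.mem_prod, IicProdIoc, funext_iff]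
        constructor
        · intro h
          refine ⟨fun i => ?_, fun i => ?_⟩
          · have := h ⟨i.1, Finset.mem_Iic.2 ((Finset.mem_Iic.1 i.2).trans n.le_succ)⟩
            rwa [dif_pos (Finset.mem_Iic.1 i.2)] at this
          · have := h ⟨i.1, Finset.mem_Iic.2 (Finset.mem_Ioc.1 i.2).2⟩
            rwa [dif_neg (Finset.mem_Ioc.1 i.2).1.not_ge] at this
        · rintro ⟨h1, h2⟩ i
          split_ifs with h
          · exact h1 _
          · exact h2 _
      rw [this, Kernel.comp_apply' _ _ _ ((measurableSet_singleton _).prod (measurableSet_singleton _))]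
      have h1 : ∀ x, (Kernel.id ×ₖ (G.walkKernel n).map (MeasurableEquiv.piSingleton (X := fun _ => G.V) n)) x
          ({r n} ×ˢ {q}) =
          ({r n} : Set _).indicator (fun _ => G.stepKernel (p n) {p (n + 1)}) x := by
        intro x
        rw [Kernel.prod_apply_prod, Kernel.id_apply,
          Measure.dirac_apply' _ (measurableSet_singleton _),
          Kernel.map_apply' _ (by fun_prop) _ (measurableSet_singleton _)]
        by_cases hx : x = r n
        · subst hx
          have h2 : MeasurableEquiv.piSingleton (X := fun _ => G.V) n ⁻¹' {q}
              = {p (n + 1)} := by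
            ext y
            simp only [Set.mem_preimage, Set.mem_singleton_iff, funext_iff]
            constructor
            · intro h
              exact h ⟨n + 1, by simp⟩
            · rintro rfl ⟨i, hi⟩
              obtain rfl : i = n + 1 := by simp at hi; omega
              rfl
          rw [h2]
          simp
          rfl
        · simp [hx]
      simp_rw [h1]
      rw [lintegral_indicator_const (measurableSet_singleton _), ih, Finset.prod_range_succ, mul_comm]
  rw [← key n, ← Kernel.traj_map_frestrictLe_apply, Measure.map_apply (by fun_prop) (measurableSet_singleton _)]
  congr 1
  ext x
  simp [funext_iff, r]

theorem walkMeasure_ne (G : LFGraph) (v : G.V) : G.walkMeasure v {x | x 0 ≠ v} = 0 := by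
  have h := G.walkMeasure_cylinder (fun _ => v) 0
  have : IsProbabilityMeasure (G.walkMeasure v) := by unfold walkMeasure; infer_instance
  have hm : MeasurableSet {x : ℕ → G.V | x 0 = v} :=
    measurableSet_eq_fun (measurable_pi_apply 0) measurable_const
  have h' : G.walkMeasure v {x | x 0 = v} = 1 := by simpa using h
  exact (prob_compl_eq_zero_iff hm).2 h'

/-! Balls and local isomorphism -/

theorem dist_iso {G H : LFGraph} (e : G.graph ≃g H.graph) (v w : G.V) :
    H.graph.dist (e v) (e w) = G.graph.dist v w := by
  have key : ∀ {G H : LFGraph} (e : G.graph ≃g H.graph) (v w : G.V),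
      H.graph.dist (e v) (e w) ≤ G.graph.dist v w := by
    intro G H e v w
    obtain ⟨p, hp⟩ := G.connected.exists_walk_length_eq_dist v w
    rw [← hp, ← SimpleGraph.Walk.length_map e.toHom p]
    exact SimpleGraph.dist_le _
  refine le_antisymm (key e v w) ?_
  simpa using key e.symm (e v) (e w)

theorem exists_adj_of_dist (G : LFGraph) {v w : G.V} {n : ℕ} (h : G.graph.dist v w = n + 1) :
    ∃ u, G.graph.dist v u = n ∧ G.graph.Adj u w := by
  obtain ⟨p, hp⟩ := G.connected.exists_walk_length_eq_dist w v
  cases p with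
  | nil => simp at h
  | @cons _ u _ hadj q =>
    rw [SimpleGraph.dist_comm, h, SimpleGraph.Walk.length_cons] at hp
    refine ⟨u, le_antisymm ?_ ?_, hadj.symm⟩
    · rw [SimpleGraph.dist_comm]
      exact (SimpleGraph.dist_le q).trans (by omega)
    · have h1 := G.connected.dist_triangle (u := v) (v := u) (w := w)
      have h2 : G.graph.dist u w = 1 := SimpleGraph.dist_eq_one_iff_adj.2 hadj.symm
      omega

theorem mem_ball_self (G : LFGraph) (v : G.V) (r : ℕ) : v ∈ G.ball v r := by
  simp [ball]

theorem ball_mono (G : LFGraph) (v : G.V) {r s : ℕ} (h : r ≤ s) : G.ball v r ⊆ G.ball v s :=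
  fun _ hw => le_trans hw h

theorem ball_finite (G : LFGraph) (v : G.V) (r : ℕ) : (G.ball v r).Finite := by
  induction r with
  | zero =>
    refine (Set.finite_singleton v).subset fun w hw => ?_
    exact (G.connected.dist_eq_zero_iff.1 (Nat.le_zero.1 hw)).symm
  | succ r ih =>
    refine (ih.union (ih.biUnion fun u _ => G.locallyFinite u)).subset fun w hw => ?_
    rcases Nat.le_succ_iff.1 (show G.graph.dist v w ≤ r + 1 from hw) with h | h
    · exact Or.inl h
    · obtain ⟨u, hu, ha⟩ := G.exists_adj_of_dist h
      exact Or.inr (Set.mem_biUnion (show u ∈ G.ball v r from hu.le) ha)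

/-- The balls of radius `r` around `x 0` in `G` and around `y 0` in `H` (as induced subgraphs)
are isomorphic, by an isomorphism that matches the marked vertices `x 0, …, x r` with
`y 0, …, y r`. -/
def BallIso (r : ℕ) (G : LFGraph) (x : ℕ → G.V) (H : LFGraph) (y : ℕ → H.V) : Prop :=
  ∃ e : G.graph.induce (G.ball (x 0) r) ≃g H.graph.induce (H.ball (y 0) r),
    ∀ i ≤ r, ∀ v, (e v : H.V) = y i ↔ (v : G.V) = x i

theorem BallIso.refl (r : ℕ) (G : LFGraph) (x : ℕ → G.V) : BallIso r G x G x :=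
  ⟨SimpleGraph.Iso.refl, fun _ _ _ => Iff.rfl⟩

theorem BallIso.symm {r : ℕ} {G H : LFGraph} {x : ℕ → G.V} {y : ℕ → H.V}
    (h : BallIso r G x H y) : BallIso r H y G x := by
  obtain ⟨e, he⟩ := h
  refine ⟨e.symm, fun i hi v => ?_⟩
  rw [← he i hi, e.apply_symm_apply]

theorem BallIso.trans {r : ℕ} {G H K : LFGraph} {x : ℕ → G.V} {y : ℕ → H.V} {z : ℕ → K.V}
    (h : BallIso r G x H y) (h' : BallIso r H y K z) : BallIso r G x K z := by
  obtain ⟨e, he⟩ := h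
  obtain ⟨f, hf⟩ := h'
  exact ⟨e.trans f, fun i hi v => (hf i hi _).trans (he i hi v)⟩

/-- An isomorphism between balls does not increase distances from a vertex, within the ball. -/
theorem ballIso_dist_le {r : ℕ} {G H : LFGraph} {a : G.V} {b : H.V}
    (e : G.graph.induce (G.ball a r) ≃g H.graph.induce (H.ball b r)) (v : G.ball a r) :
    ∀ k, G.graph.dist a v + k ≤ r → ∀ w : G.ball a r, G.graph.dist (v : G.V) w ≤ k →
      H.graph.dist (e v : H.V) (e w) ≤ k := by
  intro k
  induction k with
  | zero =>
    intro _ w hw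
    have : v = w := Subtype.ext (G.connected.dist_eq_zero_iff.1 (Nat.le_zero.1 hw))
    simp [this]
  | succ k ih =>
    intro hk w hw
    rcases Nat.le_succ_iff.1 hw with h | h
    · exact (ih (by omega) w h).trans k.le_succ
    · obtain ⟨u, hu, ha⟩ := G.exists_adj_of_dist h
      have hu' : u ∈ G.ball a r := by
        have := G.connected.dist_triangle (u := a) (v := v) (w := u)
        change G.graph.dist a u ≤ r
        omega
      have h1 := ih (by omega) ⟨u, hu'⟩ hu.le
      have h2 : (H.graph.induce (H.ball b r)).Adj (e ⟨u, hu'⟩) (e w) := e.map_adj_iff.2 ha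
      have h3 : H.graph.dist (e ⟨u, hu'⟩ : H.V) (e w) = 1 :=
        SimpleGraph.dist_eq_one_iff_adj.2 h2
      have := H.connected.dist_triangle (u := (e v : H.V)) (v := e ⟨u, hu'⟩) (w := e w)
      omega

/-- Restriction of an isomorphism of balls to a smaller ball, possibly around another vertex. -/
theorem ballIso_restrict {r k : ℕ} {G H : LFGraph} {a : G.V} {b : H.V}
    (e : G.graph.induce (G.ball a r) ≃g H.graph.induce (H.ball b r)) (v : G.ball a r)
    {c : H.V} (hc : (e v : H.V) = c) (hv : G.graph.dist a v + k ≤ r)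
    (hv' : H.graph.dist b c + k ≤ r) :
    ∃ f : G.graph.induce (G.ball v k) ≃g H.graph.induce (H.ball c k),
      ∀ w hw, (f w : H.V) = e ⟨w, hw⟩ := by
  subst hc
  have hG : ∀ w ∈ G.ball v k, w ∈ G.ball a r := by
    intro w hw
    have := G.connected.dist_triangle (u := a) (v := v) (w := w)
    change G.graph.dist v w ≤ k at hw
    change G.graph.dist a w ≤ r
    omega
  have hH : ∀ w ∈ H.ball (e v) k, w ∈ H.ball b r := by
    intro w hw
    have := H.connected.dist_triangle (u := b) (v := e v) (w := w)
    change H.graph.dist (e v) w ≤ k at hw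
    change H.graph.dist b w ≤ r
    omega
  refine ⟨⟨⟨fun w => ⟨e ⟨w, hG w w.2⟩, ballIso_dist_le e v k hv _ w.2⟩,
    fun w => ⟨e.symm ⟨w, hH w w.2⟩, ?_⟩, ?_, ?_⟩, ?_⟩, ?_⟩
  · have := ballIso_dist_le e.symm (e v) k hv' ⟨w, hH w w.2⟩ w.2
    rwa [e.symm_apply_apply] at this
  · intro w
    simp
  · intro w
    simp
  · intro w w'
    exact e.map_adj_iff
  · intro w hw
    rfl

theorem BallIso.anti {r s : ℕ} (hrs : r ≤ s) {G H : LFGraph} {x : ℕ → G.V} {y : ℕ → H.V}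
    (h : BallIso s G x H y) : BallIso r G x H y := by
  obtain ⟨e, he⟩ := h
  have h0 : (e ⟨x 0, G.mem_ball_self _ _⟩ : H.V) = y 0 := (he 0 (Nat.zero_le _) _).2 rfl
  obtain ⟨f, hf⟩ := ballIso_restrict (k := r) e ⟨x 0, G.mem_ball_self _ _⟩ h0
    (by simpa using hrs) (by simpa using hrs)
  refine ⟨f, fun i hi v => ?_⟩
  rw [hf v (G.ball_mono _ hrs v.2), he i (hi.trans hrs)]

theorem BallIso.zero (G H : LFGraph) (x : ℕ → G.V) (y : ℕ → H.V) : BallIso 0 G x H y := by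
  have hG : ∀ v : G.ball (x 0) 0, (v : G.V) = x 0 := fun v =>
    (G.connected.dist_eq_zero_iff.1 (Nat.le_zero.1 v.2)).symm
  have hH : ∀ v : H.ball (y 0) 0, (v : H.V) = y 0 := fun v =>
    (H.connected.dist_eq_zero_iff.1 (Nat.le_zero.1 v.2)).symm
  refine ⟨⟨⟨fun _ => ⟨y 0, H.mem_ball_self _ _⟩, fun _ => ⟨x 0, G.mem_ball_self _ _⟩,
    fun v => Subtype.ext (hG v).symm, fun v => Subtype.ext (hH v).symm⟩, ?_⟩, ?_⟩
  · intro v w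
    simp [hG v, hG w]
  · intro i hi v
    obtain rfl : i = 0 := by omega
    exact iff_of_true rfl (hG v)

theorem BallIso.of_iso {G H : LFGraph} (e : G.graph ≃g H.graph) {x : ℕ → G.V} {y : ℕ → H.V}
    (h : ∀ n, e (x n) = y n) (r : ℕ) : BallIso r G x H y := by
  refine ⟨⟨e.toEquiv.subtypeEquiv fun v => ?_, ?_⟩, ?_⟩
  · change _ ↔ H.graph.dist (y 0) (e v) ≤ r
    rw [← h 0, dist_iso]
    rfl
  · intro v w
    exact e.map_adj_iff
  · intro i _ v
    rw [← h i]
    exact e.injective.eq_iff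

/-- Up to isomorphism there are countably many marked balls of radius `r`. -/
theorem BallIso.countable (r : ℕ) : ∃ (β : Type) (_ : Countable β)
    (f : (Σ G : LFGraph, ℕ → G.V) → β), ∀ a b, f a = f b → BallIso r a.1 a.2 b.1 b.2 := by
  have hcode : ∀ a : (Σ G : LFGraph, ℕ → G.V), ∃ c : (Σ n : ℕ, SimpleGraph (Fin n) × (Fin (r + 1) → Set (Fin n))),
      ∃ e : a.1.graph.induce (a.1.ball (a.2 0) r) ≃g c.2.1,
        ∀ i v, e v ∈ c.2.2 i ↔ (v : a.1.V) = a.2 i := by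
    rintro ⟨G, x⟩
    have := (G.ball_finite (x 0) r).to_subtype
    obtain ⟨n, ⟨e⟩⟩ := Finite.exists_equiv_fin (G.ball (x 0) r)
    refine ⟨⟨n, (G.graph.induce (G.ball (x 0) r)).map e.toEmbedding,
      fun i => {k | (e.symm k : G.V) = x i}⟩, SimpleGraph.Iso.map e _, fun i v => ?_⟩
    change (e.symm (e v) : G.V) = x i ↔ _
    rw [e.symm_apply_apply]
  choose f e he using hcode
  refine ⟨_, ?_, f, ?_⟩
  · infer_instance
  · intro a b hab
    have key : ∀ c d : (Σ n : ℕ, SimpleGraph (Fin n) × (Fin (r + 1) → Set (Fin n))), c = d → ∀ (e : a.1.graph.induce (a.1.ball (a.2 0) r) ≃g c.2.1)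
      (_ : ∀ i v, e v ∈ c.2.2 i ↔ (v : a.1.V) = a.2 i)
      (e' : b.1.graph.induce (b.1.ball (b.2 0) r) ≃g d.2.1)
      (_ : ∀ i v, e' v ∈ d.2.2 i ↔ (v : b.1.V) = b.2 i), BallIso r a.1 a.2 b.1 b.2 := by
      rintro c _ rfl e he e' he'
      refine ⟨e.trans e'.symm, fun i hi v => ?_⟩
      have h1 := he ⟨i, Nat.lt_succ_of_le hi⟩ v
      have h2 := he' ⟨i, Nat.lt_succ_of_le hi⟩ (e'.symm (e v))
      rw [e'.apply_symm_apply] at h2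
      exact h2.symm.trans h1
    exact key _ _ hab _ (he a) _ (he b)

/-! Local determination of the law of the walk -/

instance (G : LFGraph) (v : G.V) : IsProbabilityMeasure (G.walkMeasure v) := by
  unfold walkMeasure; infer_instance

theorem walkMeasure_null (G : LFGraph) (v : G.V) (n : ℕ) (S : Set (ℕ → G.V))
    (hS : ∀ x ∈ S, G.walkMeasure v {y | ∀ i ≤ n, y i = x i} = 0) : G.walkMeasure v S = 0 := by
  let F : (ℕ → G.V) → (Finset.Iic n → G.V) := fun x i => x i
  have hsub : S ⊆ ⋃ q ∈ F '' S, {y | F y = q} := fun x hx =>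
    Set.mem_biUnion (Set.mem_image_of_mem F hx) rfl
  refine measure_mono_null hsub ((measure_biUnion_null_iff (Set.to_countable _)).2 ?_)
  rintro _ ⟨x, hx, rfl⟩
  rw [← hS x hx]
  congr 1
  ext y
  simp [F, funext_iff]

theorem walkMeasure_cylinder_zero (G : LFGraph) (v : G.V) (x : ℕ → G.V) (n : ℕ)
    (h : ¬ (x 0 = v ∧ ∀ i < n, x (i + 1) ∈ G.stepSet (x i))) :
    G.walkMeasure v {y | ∀ i ≤ n, y i = x i} = 0 := by
  by_cases h0 : x 0 = v
  · subst h0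
    rw [walkMeasure_cylinder, Finset.prod_eq_zero_iff]
    simp only [true_and, not_forall] at h
    obtain ⟨i, hi, h⟩ := h
    refine ⟨i, Finset.mem_range.2 hi, ?_⟩
    rw [stepKernel_singleton, if_neg h]
  · refine measure_mono_null (fun y hy => ?_) (G.walkMeasure_ne v)
    exact fun h => h0 ((hy 0 (Nat.zero_le _)).symm.trans h)

theorem ae_walkMeasure (G : LFGraph) (v : G.V) :
    ∀ᵐ x ∂G.walkMeasure v, x 0 = v ∧ G.IsPath x := by
  have h : ∀ n, ∀ᵐ x ∂G.walkMeasure v, x 0 = v ∧ ∀ i < n, x (i + 1) ∈ G.stepSet (x i) :=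
    fun n => G.walkMeasure_null v n _ fun x hx => G.walkMeasure_cylinder_zero v x n hx
  filter_upwards [ae_all_iff.2 h] with x hx
  exact ⟨(hx 0).1, fun n => (hx (n + 1)).2 n n.lt_succ_self⟩

theorem dist_le_of_step (G : LFGraph) (x : ℕ → G.V) (n : ℕ)
    (h : ∀ i < n, x (i + 1) ∈ G.stepSet (x i)) : G.graph.dist (x 0) (x n) ≤ n := by
  induction n with
  | zero => simp
  | succ n ih =>
    have h1 := ih fun i hi => h i (hi.trans n.lt_succ_self)
    rcases h n n.lt_succ_self with ha | ⟨ha, -⟩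
    · have := G.connected.dist_triangle (u := x 0) (v := x n) (w := x (n + 1))
      have h2 : G.graph.dist (x n) (x (n + 1)) = 1 := SimpleGraph.dist_eq_one_iff_adj.2 ha
      omega
    · rw [ha]
      omega

theorem BallIso.mk' {r : ℕ} {G H : LFGraph} {a : G.V} {b : H.V} {x : ℕ → G.V} {y : ℕ → H.V}
    (ha : x 0 = a) (hb : y 0 = b)
    (e : G.graph.induce (G.ball a r) ≃g H.graph.induce (H.ball b r))
    (he : ∀ i ≤ r, ∀ v, (e v : H.V) = y i ↔ (v : G.V) = x i) : BallIso r G x H y := by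
  subst ha hb
  exact ⟨e, he⟩

theorem BallIso.congr {r : ℕ} {G : LFGraph} {x y : ℕ → G.V} (h : ∀ i ≤ r, y i = x i) :
    BallIso r G x G y :=
  BallIso.mk' (a := x 0) (b := x 0) rfl (h 0 (Nat.zero_le _)) SimpleGraph.Iso.refl
    fun i hi _ => by rw [h i hi]; rfl

theorem measurableSet_of_finite_dep {V : Type*} [MeasurableSpace V] [DiscreteMeasurableSpace V]
    [Countable V] (n : ℕ) (S : Set (ℕ → V))
    (hS : ∀ x ∈ S, ∀ y, (∀ i ≤ n, y i = x i) → y ∈ S) : MeasurableSet S := by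
  let F : (ℕ → V) → (Finset.Iic n → V) := fun x i => x i
  have hF : Measurable F := measurable_pi_lambda _ fun i => measurable_pi_apply _
  have : S = F ⁻¹' (F '' S) := by
    refine Set.Subset.antisymm (Set.subset_preimage_image _ _) ?_
    rintro y ⟨x, hx, hxy⟩
    exact hS x hx y fun i hi => (congrFun hxy ⟨i, Finset.mem_Iic.2 hi⟩).symm
  rw [this]
  exact hF (.of_discrete)

theorem measurableSet_isPath (G : LFGraph) : MeasurableSet {x | G.IsPath x} := by
  have : {x | G.IsPath x} = ⋂ n, {x | x (n + 1) ∈ G.stepSet (x n)} := by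
    ext x; simp [IsPath]
  rw [this]
  refine MeasurableSet.iInter fun n => measurableSet_of_finite_dep (n + 1) _ ?_
  intro x hx y hy
  change y (n + 1) ∈ G.stepSet (y n)
  rw [hy n (by omega), hy (n + 1) le_rfl]
  exact hx

theorem measurableSet_ballIso (r : ℕ) (G H : LFGraph) (y : ℕ → H.V) :
    MeasurableSet {x | BallIso r G x H y} :=
  measurableSet_of_finite_dep r _ fun _ hx _ h => (BallIso.congr h).symm.trans hx

theorem walkMeasure_local {r : ℕ} {G H : LFGraph} {a : G.V} {b : H.V}
    (h : BallIso r G (fun _ => a) H fun _ => b) (K : LFGraph) (z : ℕ → K.V) :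
    G.walkMeasure a {x | BallIso r G x K z} = H.walkMeasure b {x | BallIso r H x K z} := by
  classical
  obtain ⟨e, he⟩ := h
  have hea : (e ⟨a, G.mem_ball_self a r⟩ : H.V) = b := (he 0 (Nat.zero_le _) _).2 rfl
  let f : G.V → H.V := fun v => if h : v ∈ G.ball a r then e ⟨v, h⟩ else b
  have hf : ∀ (v : G.V) (h : v ∈ G.ball a r), f v = e ⟨v, h⟩ := fun v h => dif_pos h
  have hfa : f a = b := (hf a (G.mem_ball_self a r)).trans hea
  have hfi : Set.InjOn f (G.ball a r) := by
    intro v hv w hw hvw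
    rw [hf v hv, hf w hw] at hvw
    exact congrArg Subtype.val (e.injective (Subtype.ext hvw))
  have hstep : ∀ (v : G.V), G.graph.dist a v + 1 ≤ r → G.stepSet v ⊆ G.ball a r := by
    rintro v hv w (hw | ⟨rfl, -⟩)
    · have := G.connected.dist_triangle (u := a) (v := v) (w := w)
      have h2 : G.graph.dist v w = 1 := SimpleGraph.dist_eq_one_iff_adj.2 hw
      change G.graph.dist a w ≤ r
      omega
    · exact (Nat.le_succ _).trans hv
  have hstep' : ∀ (v : H.V), H.graph.dist b v + 1 ≤ r → H.stepSet v ⊆ H.ball b r := by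
    rintro v hv w (hw | ⟨rfl, -⟩)
    · have := H.connected.dist_triangle (u := b) (v := v) (w := w)
      have h2 : H.graph.dist v w = 1 := SimpleGraph.dist_eq_one_iff_adj.2 hw
      change H.graph.dist b w ≤ r
      omega
    · exact (Nat.le_succ _).trans hv
  have hadj : ∀ v w : G.ball a r, H.graph.Adj (e v) (e w) ↔ G.graph.Adj v w := fun v w =>
    e.map_adj_iff
  have hmem : ∀ v w : G.ball a r, G.graph.dist a v + 1 ≤ r → H.graph.dist b (e v) + 1 ≤ r →
      ((e w : H.V) ∈ H.stepSet (e v) ↔ (w : G.V) ∈ G.stepSet v) := by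
    intro v w hv hv'
    refine or_congr (hadj v w) (and_congr ?_ ⟨fun h u hu => ?_, fun h u hu => ?_⟩)
    · rw [← Subtype.ext_iff, ← Subtype.ext_iff, e.injective.eq_iff]
    · exact h _ ((hadj v ⟨u, hstep v hv (Or.inl hu)⟩).2 hu)
    · refine h (e.symm ⟨u, hstep' _ hv' (Or.inl hu)⟩) ((hadj v _).1 ?_)
      rwa [e.apply_symm_apply]
  have hker : ∀ v w : G.ball a r, G.graph.dist a v + 1 ≤ r → H.graph.dist b (e v) + 1 ≤ r →
      G.stepKernel v {(w : G.V)} = H.stepKernel (e v) {(e w : H.V)} := by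
    intro v w hv hv'
    have himg : H.stepSet (e v) = f '' G.stepSet v := by
      ext u
      constructor
      · intro hu
        have hub := hstep' _ hv' hu
        refine ⟨e.symm ⟨u, hub⟩, ?_, ?_⟩
        · rw [← hmem v _ hv hv', e.apply_symm_apply]
          exact hu
        · rw [hf _ (e.symm ⟨u, hub⟩).2]
          simp
      · rintro ⟨u, hu, rfl⟩
        rw [hf u (hstep v hv hu)]
        exact (hmem v ⟨u, hstep v hv hu⟩ hv hv').2 hu
    rw [stepKernel_singleton, stepKernel_singleton]
    simp only [hmem v w hv hv']
    rw [himg, (hfi.mono (hstep v hv)).ncard_image]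
  let F : (ℕ → H.V) → (Finset.Iic r → H.V) := fun x i => x i
  have hF : Measurable F := measurable_pi_lambda _ fun i => measurable_pi_apply _
  let fs : (ℕ → G.V) → (ℕ → H.V) := fun x n => f (x n)
  have hfs : Measurable fs :=
    measurable_pi_lambda _ fun n => (Measurable.of_discrete (f := f)).comp (measurable_pi_apply n)
  have hle : ∀ y : ℕ → H.V, H.walkMeasure b {x | ∀ i ≤ r, x i = y i} ≤
      G.walkMeasure a {x | ∀ i ≤ r, f (x i) = y i} := by
    intro y
    by_cases hy : y 0 = b ∧ ∀ i < r, y (i + 1) ∈ H.stepSet (y i)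
    · obtain ⟨h0, hy⟩ := hy
      have hd : ∀ i ≤ r, H.graph.dist b (y i) ≤ i := fun i hi => by
        rw [← h0]; exact H.dist_le_of_step y i fun j hj => hy j (by omega)
      let q : ℕ → G.ball a r := fun i =>
        if h : i ≤ r then e.symm ⟨y i, (hd i h).trans h⟩ else ⟨a, G.mem_ball_self a r⟩
      have hq : ∀ i ≤ r, (e (q i) : H.V) = y i := fun i hi => by
        simp [q, hi]
      have hq0 : (q 0 : G.V) = a := by
        have : e (q 0) = e ⟨a, G.mem_ball_self a r⟩ := by
          apply Subtype.ext
          rw [hq 0 (Nat.zero_le _), h0, hea]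
        rw [e.injective this]
      have hdq : ∀ i ≤ r, G.graph.dist a (q i) ≤ i := fun i hi => by
        have h3 := ballIso_dist_le e.symm ⟨b, H.mem_ball_self b r⟩ i (by simpa using hi)
          ⟨y i, (hd i hi).trans hi⟩ (hd i hi)
        have h4 : e.symm ⟨b, H.mem_ball_self b r⟩ = ⟨a, G.mem_ball_self a r⟩ := by
          rw [← e.injective.eq_iff, e.apply_symm_apply]
          exact Subtype.ext hea.symm
        rw [h4] at h3
        simpa [q, hi] using h3
      calc H.walkMeasure b {x | ∀ i ≤ r, x i = y i}
          = ∏ i ∈ Finset.range r, H.stepKernel (y i) {y (i + 1)} := by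
            rw [← h0, walkMeasure_cylinder]
        _ = ∏ i ∈ Finset.range r, G.stepKernel (q i) {(q (i + 1) : G.V)} := by
            refine Finset.prod_congr rfl fun i hi => ?_
            have hi := Finset.mem_range.1 hi
            rw [hker (q i) (q (i + 1)), hq i hi.le, hq (i + 1) hi]
            · exact (Nat.succ_le_succ (hdq i hi.le)).trans hi
            · rw [hq i hi.le]
              exact (Nat.succ_le_succ (hd i hi.le)).trans hi
        _ = G.walkMeasure a {x | ∀ i ≤ r, x i = q i} := by
            have hc := G.walkMeasure_cylinder (fun i => (q i : G.V)) r
            beta_reduce at hc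
            rw [hq0] at hc
            exact hc.symm
        _ ≤ _ := by
            refine measure_mono fun x hx i hi => ?_
            rw [hx i hi, hf _ (q i).2]
            exact hq i hi
    · rw [H.walkMeasure_cylinder_zero b y r hy]
      exact zero_le
  have hmarg : (H.walkMeasure b).map F = ((G.walkMeasure a).map fs).map F := by
    have i1 := Measure.isProbabilityMeasure_map (μ := H.walkMeasure b) hF.aemeasurable
    have i2 := Measure.isProbabilityMeasure_map (μ := G.walkMeasure a) hfs.aemeasurable
    have i3 := Measure.isProbabilityMeasure_map (μ := (G.walkMeasure a).map fs) hF.aemeasurable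
    refine Measure.eq_of_le_of_measure_univ_eq ?_ (by rw [measure_univ, measure_univ])
    refine Measure.le_iff.2 fun s hs => ?_
    rw [← Measure.tsum_indicator_apply_singleton _ s hs,
      ← Measure.tsum_indicator_apply_singleton _ s hs]
    refine ENNReal.tsum_le_tsum fun q => Set.indicator_le_indicator ?_
    rw [Measure.map_apply hF (measurableSet_singleton q), Measure.map_map hF hfs,
      Measure.map_apply (hF.comp hfs) (measurableSet_singleton q)]
    let y : ℕ → H.V := fun i => if h : i ≤ r then q ⟨i, Finset.mem_Iic.2 h⟩ else b
    have hy : ∀ x : ℕ → H.V, F x = q ↔ ∀ i ≤ r, x i = y i := by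
      intro x
      constructor
      · rintro rfl i hi
        simp [y, hi, F]
      · intro h
        funext ⟨i, hi⟩
        have hi' := Finset.mem_Iic.1 hi
        simpa [y, hi'] using h i hi'
    have e1 : F ⁻¹' {q} = {x | ∀ i ≤ r, x i = y i} := Set.ext fun x => hy x
    have e2 : (F ∘ fs) ⁻¹' {q} = {x | ∀ i ≤ r, f (x i) = y i} := Set.ext fun x => hy (fs x)
    rw [e1, e2]
    exact hle y
  have hEF : {x | BallIso r H x K z} = F ⁻¹' (F '' {x | BallIso r H x K z}) := by
    refine Set.Subset.antisymm (Set.subset_preimage_image _ _) ?_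
    rintro y ⟨x, hx, hxy⟩
    have : BallIso r H x H y :=
      BallIso.congr fun i hi => (congrFun hxy ⟨i, Finset.mem_Iic.2 hi⟩).symm
    exact this.symm.trans hx
  have h1 : H.walkMeasure b {x | BallIso r H x K z} =
      G.walkMeasure a {x | BallIso r H (fs x) K z} := by
    rw [hEF, ← Measure.map_apply hF .of_discrete, hmarg, Measure.map_apply hF .of_discrete, ← hEF,
      Measure.map_apply hfs (measurableSet_ballIso r H K z)]
    rfl
  rw [h1]
  refine measure_congr ?_
  filter_upwards [G.ae_walkMeasure a] with x ⟨hx0, hx⟩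
  have hxb : ∀ i ≤ r, x i ∈ G.ball a r := fun i hi => by
    rw [← hx0]
    exact (G.dist_le_of_step x i fun j _ => hx j).trans hi
  have hiso : BallIso r G x H (fs x) := by
    refine BallIso.mk' hx0 (show f (x 0) = b by rw [hx0, hfa]) e fun i hi v => ?_
    change _ = f (x i) ↔ _
    rw [hf _ (hxb i hi), ← Subtype.ext_iff, e.injective.eq_iff]
    exact Subtype.ext_iff
  exact propext ⟨fun h => hiso.symm.trans h, fun h => hiso.trans h⟩

theorem BallIso.const {r : ℕ} {G H : LFGraph} {x : ℕ → G.V} {y : ℕ → H.V}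
    (h : BallIso r G x H y) : BallIso r G (fun _ => x 0) H fun _ => y 0 := by
  obtain ⟨e, he⟩ := h
  exact ⟨e, fun i _ => he 0 (Nat.zero_le _)⟩

theorem BallIso.shift {r n : ℕ} {G H : LFGraph} {x : ℕ → G.V} {y : ℕ → H.V}
    (hx : G.IsPath x) (hy : H.IsPath y) (h : BallIso (n + r) G x H y) :
    BallIso r G (fun k => x (k + n)) H fun k => y (k + n) := by
  obtain ⟨e, he⟩ := h
  have hxn := G.dist_le_of_step x n fun i _ => hx i
  have hyn := H.dist_le_of_step y n fun i _ => hy i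
  have hxb : x n ∈ G.ball (x 0) (n + r) := hxn.trans (Nat.le_add_right _ _)
  obtain ⟨f, hf⟩ := ballIso_restrict (k := r) e ⟨x n, hxb⟩
    ((he n (Nat.le_add_right _ _) _).2 rfl) (Nat.add_le_add_right hxn r)
    (Nat.add_le_add_right hyn r)
  refine BallIso.mk' (a := x n) (b := y n) (by simp) (by simp) f fun i hi v => ?_
  have hv : (v : G.V) ∈ G.ball (x 0) (n + r) := by
    have h1 := G.connected.dist_triangle (u := x 0) (v := x n) (w := v)
    have h2 : G.graph.dist (x n) v ≤ r := v.2
    change G.graph.dist (x 0) v ≤ n + r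
    omega
  rw [hf v hv, he (i + n) (by omega)]

end LFGraph

/-! Rooted graphs and graphs with a path, up to isomorphism -/

/-- A rooted graph. -/
structure RootedLFGraph extends LFGraph where
  root : V

/-- A graph with a semi-infinite path. -/
structure PathLFGraph extends LFGraph where
  path : ℕ → V
  isPath : toLFGraph.IsPath path

/-- Isomorphism of rooted graphs. -/
instance RootedLFGraph.setoid : Setoid RootedLFGraph where
  r A B := ∃ e : A.graph ≃g B.graph, e A.root = B.root
  iseqv :=
    { refl := fun _ => ⟨SimpleGraph.Iso.refl, rfl⟩
      symm := fun ⟨e, he⟩ => ⟨e.symm, by rw [← he, e.symm_apply_apply]⟩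
      trans := fun ⟨e, he⟩ ⟨f, hf⟩ => ⟨e.trans f, by rw [← hf, ← he]; rfl⟩ }

/-- Isomorphism of graphs with a path. -/
instance PathLFGraph.setoid : Setoid PathLFGraph where
  r A B := ∃ e : A.graph ≃g B.graph, ∀ n, e (A.path n) = B.path n
  iseqv :=
    { refl := fun _ => ⟨SimpleGraph.Iso.refl, fun _ => rfl⟩
      symm := fun ⟨e, he⟩ => ⟨e.symm, fun n => by rw [← he n, e.symm_apply_apply]⟩
      trans := fun ⟨e, he⟩ ⟨f, hf⟩ => ⟨e.trans f, fun n => by rw [← hf n, ← he n]; rfl⟩ }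

/-- The space `𝒢_•` of isomorphism classes of rooted graphs. -/
def RootedGraph : Type 1 := Quotient RootedLFGraph.setoid

/-- The space of isomorphism classes of graphs with a semi-infinite path. -/
def PathGraph : Type 1 := Quotient PathLFGraph.setoid

namespace RootedGraph

/-- The isomorphism class of `A`. -/
def mk (A : RootedLFGraph) : RootedGraph := Quotient.mk _ A

theorem ind {p : RootedGraph → Prop} (h : ∀ A, p (mk A)) (a : RootedGraph) : p a :=
  Quotient.inductionOn a h

/-- The balls of radius `r` around the roots are isomorphic as rooted graphs. -/
def Level (r : ℕ) (a b : RootedGraph) : Prop :=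
  Quotient.liftOn₂ a b
    (fun A B => LFGraph.BallIso r A.toLFGraph (fun _ => A.root) B.toLFGraph fun _ => B.root)
    fun _ _ _ _ ⟨e, he⟩ ⟨f, hf⟩ =>
      have h1 := LFGraph.BallIso.of_iso e (fun _ => he) r
      have h2 := LFGraph.BallIso.of_iso f (fun _ => hf) r
      propext ⟨fun h => (h1.symm.trans h).trans h2, fun h => (h1.trans h).trans h2.symm⟩

theorem level_mk (r : ℕ) (A B : RootedLFGraph) : Level r (mk A) (mk B) ↔
    LFGraph.BallIso r A.toLFGraph (fun _ => A.root) B.toLFGraph fun _ => B.root := Iff.rfl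

theorem isLevels : IsLevels Level where
  equiv r := by
    refine ⟨fun a => ?_, fun {a b} => ?_, fun {a b c} => ?_⟩
    · induction a using ind with
      | h A => exact (level_mk r A A).2 (LFGraph.BallIso.refl r _ _)
    · induction a using ind with
      | h A =>
        induction b using ind with
        | h B => exact fun h => (level_mk r B A).2 ((level_mk r A B).1 h).symm
    · induction a using ind with
      | h A =>
        induction b using ind with
        | h B =>
          induction c using ind with
          | h C => exact fun h h' =>
              (level_mk r A C).2 (((level_mk r A B).1 h).trans ((level_mk r B C).1 h'))
  anti {r s a b} hrs := by
    induction a using ind with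
    | h A =>
      induction b using ind with
      | h B => exact fun h => (level_mk r A B).2 (((level_mk s A B).1 h).anti hrs)
  zero a b := by
    induction a using ind with
    | h A =>
      induction b using ind with
      | h B => exact (level_mk 0 A B).2 (LFGraph.BallIso.zero _ _ _ _)

/-- The local distance `d_loc`. -/
noncomputable instance : PseudoMetricSpace RootedGraph := isLevels.pseudoMetric

/-- The Borel σ-algebra of `d_loc`. -/
noncomputable instance instMeasurableSpace : MeasurableSpace RootedGraph := borel RootedGraph

instance : BorelSpace RootedGraph := ⟨rfl⟩

end RootedGraph

namespace PathGraph

/-- The isomorphism class of `A`. -/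
def mk (A : PathLFGraph) : PathGraph := Quotient.mk _ A

theorem ind {p : PathGraph → Prop} (h : ∀ A, p (mk A)) (a : PathGraph) : p a :=
  Quotient.inductionOn a h

/-- The balls of radius `r` around the starting points are isomorphic, by an isomorphism that
matches the first `r` steps of the paths (which stay in these balls). -/
def Level (r : ℕ) (a b : PathGraph) : Prop :=
  Quotient.liftOn₂ a b
    (fun A B => LFGraph.BallIso r A.toLFGraph A.path B.toLFGraph B.path)
    fun _ _ _ _ ⟨e, he⟩ ⟨f, hf⟩ =>
      have h1 := LFGraph.BallIso.of_iso e he r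
      have h2 := LFGraph.BallIso.of_iso f hf r
      propext ⟨fun h => (h1.symm.trans h).trans h2, fun h => (h1.trans h).trans h2.symm⟩

theorem level_mk (r : ℕ) (A B : PathLFGraph) : Level r (mk A) (mk B) ↔
    LFGraph.BallIso r A.toLFGraph A.path B.toLFGraph B.path := Iff.rfl

theorem isLevels : IsLevels Level where
  equiv r := by
    refine ⟨fun a => ?_, fun {a b} => ?_, fun {a b c} => ?_⟩
    · induction a using ind with
      | h A => exact (level_mk r A A).2 (LFGraph.BallIso.refl r _ _)
    · induction a using ind with
      | h A =>
        induction b using ind with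
        | h B => exact fun h => (level_mk r B A).2 ((level_mk r A B).1 h).symm
    · induction a using ind with
      | h A =>
        induction b using ind with
        | h B =>
          induction c using ind with
          | h C => exact fun h h' =>
              (level_mk r A C).2 (((level_mk r A B).1 h).trans ((level_mk r B C).1 h'))
  anti {r s a b} hrs := by
    induction a using ind with
    | h A =>
      induction b using ind with
      | h B => exact fun h => (level_mk r A B).2 (((level_mk s A B).1 h).anti hrs)
  zero a b := by
    induction a using ind with
    | h A =>
      induction b using ind with
      | h B => exact (level_mk 0 A B).2 (LFGraph.BallIso.zero _ _ _ _)

/-- The variant of `d_loc` for graphs with a path. -/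
noncomputable instance : PseudoMetricSpace PathGraph := isLevels.pseudoMetric

/-- The Borel σ-algebra. -/
noncomputable instance instMeasurableSpace : MeasurableSpace PathGraph := borel PathGraph

instance : BorelSpace PathGraph := ⟨rfl⟩

theorem generateFrom_cells :
    instMeasurableSpace = MeasurableSpace.generateFrom (IsLevels.cells Level) := by
  refine isLevels.borel_eq isLevels.isOpen_iff_level fun r => ?_
  obtain ⟨β, hβ, f, hf⟩ := LFGraph.BallIso.countable r
  refine ⟨β, hβ, fun a => f ⟨a.out.toLFGraph, a.out.path⟩, fun a b hab => ?_⟩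
  rw [← a.out_eq, ← b.out_eq]
  exact hf _ _ hab

/-- The shift `θ (G, (x_n)) = (G, (x_{n+1}))`. -/
def shift : PathGraph → PathGraph :=
  Quotient.map (fun A => ⟨A.toLFGraph, fun n => A.path (n + 1), fun n => A.isPath (n + 1)⟩)
    fun _ _ ⟨e, he⟩ => ⟨e, fun n => he (n + 1)⟩

/-- The graph rerooted at time `n`: `(G, (x_k)) ↦ (G, x_n)`. -/
def rootAt (n : ℕ) : PathGraph → RootedGraph :=
  Quotient.map (fun A => ⟨A.toLFGraph, A.path n⟩) fun _ _ ⟨e, he⟩ => ⟨e, he n⟩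

theorem measurable_shift : Measurable shift := by
  refine Continuous.measurable (continuous_def.2 fun U hU => ?_)
  refine (isLevels.isOpen_iff_level _).2 fun a ha => ?_
  obtain ⟨r, hr⟩ := (isLevels.isOpen_iff_level _).1 hU _ ha
  refine ⟨1 + r, fun b hb => hr _ ?_⟩
  induction a using ind with
  | h A =>
    induction b using ind with
    | h B => exact LFGraph.BallIso.shift A.isPath B.isPath hb

theorem measurable_rootAt (n : ℕ) : Measurable (rootAt n) := by
  refine Continuous.measurable (continuous_def.2 fun U hU => ?_)
  refine (isLevels.isOpen_iff_level _).2 fun a ha => ?_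
  obtain ⟨r, hr⟩ := (RootedGraph.isLevels.isOpen_iff_level _).1 hU _ ha
  refine ⟨n + r, fun b hb => hr _ ?_⟩
  induction a using ind with
  | h A =>
    induction b using ind with
    | h B =>
      have := (LFGraph.BallIso.shift A.isPath B.isPath hb).const
      simp only [Nat.zero_add] at this
      exact this

/-- The range `R_n = #{x_0, …, x_n}`. -/
noncomputable def range (n : ℕ) : PathGraph → ℕ :=
  Quotient.lift (fun A => (A.path '' Set.Iic n).ncard) fun A B ⟨e, he⟩ => by
    have : B.path '' Set.Iic n = e '' (A.path '' Set.Iic n) := by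
      rw [← Set.image_comp]
      exact Set.image_congr fun i _ => (he i).symm
    rw [this, Set.ncard_image_of_injective _ e.injective]

/-- The distance `D_n = d_gr(x_0, x_n)`. -/
noncomputable def dist (n : ℕ) : PathGraph → ℕ :=
  Quotient.lift (fun A => A.graph.dist (A.path 0) (A.path n)) fun A B ⟨e, he⟩ => by
    rw [← he, ← he]
    exact (LFGraph.dist_iso (G := A.toLFGraph) (H := B.toLFGraph) e _ _).symm

/-- The set of graphs with a path that never returns to its starting point. -/
def neverReturns : Set PathGraph :=
  {a | Quotient.liftOn a (fun A => ∀ i ≥ 1, A.path i ≠ A.path 0) fun A B ⟨e, he⟩ => by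
    simp only [← he, ne_eq, e.injective.eq_iff]}

end PathGraph

/-! The simple random walk on a random rooted graph -/

/-- The law of `(G, (X_n))`, where `(X_n)` is the simple random walk on `G` started at `ρ`, for a
rooted graph `(G, ρ)`. The walk is almost surely a path, and `Measure.comap` restricts its law to
the paths. -/
noncomputable def RootedLFGraph.walkLaw (A : RootedLFGraph) : Measure PathGraph :=
  ((A.walkMeasure A.root).comap (Subtype.val : {x // A.IsPath x} → ℕ → A.V)).map
    fun x => PathGraph.mk ⟨A.toLFGraph, x.1, x.2⟩

theorem RootedLFGraph.measurable_mk (A : RootedLFGraph) :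
    Measurable fun x : {x // A.IsPath x} =>
      PathGraph.mk ⟨A.toLFGraph, x.1, x.2⟩ := by
  rw [PathGraph.generateFrom_cells]
  refine measurable_generateFrom ?_
  rintro _ ⟨r, p, rfl⟩
  induction p using PathGraph.ind with
  | h P =>
    have := (A.measurableSet_ballIso r P.toLFGraph P.path).preimage
      (measurable_subtype_coe (p := fun x => A.IsPath x))
    convert this using 1
    ext x
    exact ⟨fun h => LFGraph.BallIso.symm h, fun h => LFGraph.BallIso.symm h⟩

theorem RootedLFGraph.walkLaw_cell (A : RootedLFGraph) (r : ℕ) (P : PathLFGraph) :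
    A.walkLaw {b | PathGraph.Level r (PathGraph.mk P) b} =
      A.walkMeasure A.root {x | LFGraph.BallIso r A.toLFGraph x P.toLFGraph P.path} := by
  have hm : MeasurableSet {b | PathGraph.Level r (PathGraph.mk P) b} := by
    rw [PathGraph.generateFrom_cells]
    exact MeasurableSpace.measurableSet_generateFrom ⟨r, _, rfl⟩
  rw [walkLaw, Measure.map_apply A.measurable_mk hm]
  have h := comap_subtype_coe_apply A.measurableSet_isPath (A.walkMeasure A.root)
    ((fun x : {x // A.IsPath x} => PathGraph.mk ⟨A.toLFGraph, x.1, x.2⟩) ⁻¹'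
      {b | PathGraph.Level r (PathGraph.mk P) b})
  refine h.trans (measure_congr ?_)
  filter_upwards [A.ae_walkMeasure A.root] with x hx
  refine propext ⟨?_, fun h => ⟨⟨x, hx.2⟩, LFGraph.BallIso.symm h, rfl⟩⟩
  rintro ⟨y, hy, rfl⟩
  exact LFGraph.BallIso.symm hy

instance (A : RootedLFGraph) : IsProbabilityMeasure A.walkLaw := by
  constructor
  rw [RootedLFGraph.walkLaw, Measure.map_apply A.measurable_mk .univ]
  have h := comap_subtype_coe_apply A.measurableSet_isPath (A.walkMeasure A.root) Set.univ
  refine h.trans ?_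
  rw [← measure_univ (μ := A.walkMeasure A.root)]
  refine measure_congr ?_
  filter_upwards [A.ae_walkMeasure A.root] with x hx
  exact propext ⟨fun _ => trivial, fun _ => ⟨⟨x, hx.2⟩, trivial, rfl⟩⟩

theorem RootedLFGraph.walkLaw_cell_congr {A B : RootedLFGraph} {r : ℕ}
    (h : RootedGraph.Level r (RootedGraph.mk A) (RootedGraph.mk B)) (p : PathGraph) :
    A.walkLaw {b | PathGraph.Level r p b} = B.walkLaw {b | PathGraph.Level r p b} := by
  induction p using PathGraph.ind with
  | h P =>
    rw [walkLaw_cell, walkLaw_cell]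
    exact LFGraph.walkMeasure_local h _ _

theorem RootedLFGraph.walkLaw_congr {A B : RootedLFGraph} (h : A ≈ B) :
    A.walkLaw = B.walkLaw := by
  refine ext_of_generate_finite _ PathGraph.generateFrom_cells PathGraph.isLevels.isPiSystem_cells
    ?_ (by rw [measure_univ, measure_univ])
  rintro _ ⟨r, p, rfl⟩
  refine RootedLFGraph.walkLaw_cell_congr ?_ p
  rw [show RootedGraph.mk A = RootedGraph.mk B from Quotient.sound h]
  exact (RootedGraph.isLevels.equiv r).refl _

/-- The conditional law of `(G, (X_n))` given the random rooted graph `(G, ρ)`. -/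
noncomputable def walkKernel : Kernel RootedGraph PathGraph where
  toFun := Quotient.lift RootedLFGraph.walkLaw fun _ _ => RootedLFGraph.walkLaw_congr
  measurable' := by
    have : ∀ g : RootedGraph, IsProbabilityMeasure
        (Quotient.lift RootedLFGraph.walkLaw (fun _ _ => RootedLFGraph.walkLaw_congr) g) :=
      fun g => Quotient.inductionOn g fun A => inferInstanceAs (IsProbabilityMeasure A.walkLaw)
    refine Measurable.measure_of_isPiSystem_of_isProbabilityMeasure PathGraph.generateFrom_cells
      PathGraph.isLevels.isPiSystem_cells ?_
    rintro _ ⟨r, p, rfl⟩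
    intro U _
    refine ((RootedGraph.isLevels.isOpen_iff_level _).2 fun a ha =>
      ⟨r, fun b hb => ?_⟩).measurableSet
    induction a using RootedGraph.ind with
    | h A =>
      induction b using RootedGraph.ind with
      | h B =>
        have h := RootedLFGraph.walkLaw_cell_congr hb p
        change A.walkLaw _ ∈ U at ha
        change B.walkLaw _ ∈ U
        rwa [← h]

instance : IsMarkovKernel walkKernel :=
  ⟨fun g => Quotient.inductionOn g fun A => inferInstanceAs (IsProbabilityMeasure A.walkLaw)⟩

/-- The law `ℙ` of `(G, (X_n))` when `(G, ρ)` has law `P` and, conditionally on `(G, ρ)`, the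
process `(X_n)` is the simple random walk on `G` started at `ρ`. -/
noncomputable def walkLaw (P : Measure RootedGraph) : Measure PathGraph :=
  P.bind walkKernel

/-- Stationarity: `(G, X_n)` has the same law as `(G, ρ)` for all `n ≥ 1`. -/
def IsStationaryRandomGraph (P : Measure RootedGraph) : Prop :=
  ∀ n ≥ 1, (walkLaw P).map (PathGraph.rootAt n) = P

/-- Ergodicity: every shift-invariant event has probability `0` or `1` under `ℙ`. -/
def IsErgodicRandomGraph (P : Measure RootedGraph) : Prop :=
  PreErgodic PathGraph.shift (walkLaw P)

/-!
Simple random walk on a stationary ergodic random graph is an ergodic dynamical system: by the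
Markov property (`RootedLFGraph.map_shift_walkLaw`) the shifted walk, given `(G, X_0, X_1)`, is a
simple random walk on `(G, X_1)`, and `(G, X_1)` has the law of `(G, ρ)` by stationarity, so the
shift preserves `ℙ` (`IsStationaryRandomGraph.measurePreserving_shift`).

Along the shift, both the distance `D_n` and the number `R_{n-1}` of vertices visited before time
`n` are subadditive, and both lie between `0` and `n`. A subadditive ergodic theorem for such
bounded processes (`IsBoundedSubadditive.exists_ae_tendsto`) gives almost sure convergence to the
limit of the means divided by `n`; convergence in `L¹` follows by dominated convergence. The lower
bound in that theorem is the greedy block decomposition of Katznelson and Weiss. Applied to the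
sums of `K - g`, it yields the upper bound in Birkhoff's theorem for a bounded function `g`, and
Birkhoff's theorem for `f m` bounds the process from above, by averaging the decompositions of
`[0, n)` into blocks of length `m` over the starting point of the first block.

The limit for the range is identified by counting each visited vertex at its last visit before time
`n`: by stationarity `𝔼 R_{n-1}` is the sum over `k < n` of the probability that the walk does not
return to `ρ` up to time `k`, and these probabilities decrease to that of never returning.
-/

/-! ### The subadditive ergodic theorem for bounded processes -/

/-- A measurable process `f` which is subadditive along the orbits of `T`, with values
`0 ≤ f n ≤ C * n`. -/
structure IsBoundedSubadditive {Ω : Type*} [MeasurableSpace Ω] (T : Ω → Ω) (C : ℝ)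
    (f : ℕ → Ω → ℝ) : Prop where
  measurable : ∀ n, Measurable (f n)
  nonneg : ∀ n x, 0 ≤ f n x
  le : ∀ n x, f n x ≤ C * n
  add_le : ∀ m n x, f (m + n) x ≤ f m x + f n (T^[m] x)

/-- Almost sure convergence can be checked one bound at a time. -/
theorem ae_tendsto_of_forall_eventually_lt {Ω : Type*} [MeasurableSpace Ω] {μ : Measure Ω}
    {u : ℕ → Ω → ℝ} {γ : ℝ} (h1 : ∀ b < γ, ∀ᵐ x ∂μ, ∀ᶠ n in atTop, b < u n x)
    (h2 : ∀ b > γ, ∀ᵐ x ∂μ, ∀ᶠ n in atTop, u n x < b) :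
    ∀ᵐ x ∂μ, Tendsto (fun n => u n x) atTop (𝓝 γ) := by
  have h1' : ∀ᵐ x ∂μ, ∀ q : ℚ, (q : ℝ) < γ → ∀ᶠ n in atTop, (q : ℝ) < u n x :=
    ae_all_iff.2 fun q => eventually_imp_distrib_left.2 (h1 q)
  have h2' : ∀ᵐ x ∂μ, ∀ q : ℚ, (q : ℝ) > γ → ∀ᶠ n in atTop, u n x < q :=
    ae_all_iff.2 fun q => eventually_imp_distrib_left.2 (h2 q)
  filter_upwards [h1', h2'] with x hx1 hx2
  refine tendsto_order.2 ⟨fun b hb => ?_, fun b hb => ?_⟩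
  · obtain ⟨q, hq1, hq2⟩ := exists_rat_btwn hb
    exact (hx1 q hq2).mono fun n hn => hq1.trans hn
  · obtain ⟨q, hq1, hq2⟩ := exists_rat_btwn hb
    exact (hx2 q hq1).mono fun n hn => hn.trans hq2

theorem integral_birkhoffSum {Ω : Type*} [MeasurableSpace Ω] {T : Ω → Ω} {μ : Measure Ω}
    (hT : MeasurePreserving T μ μ) {g : Ω → ℝ} (hg : Integrable g μ) (n : ℕ) :
    ∫ x, birkhoffSum T g n x ∂μ = n * ∫ x, g x ∂μ := by
  simp only [birkhoffSum]
  rw [integral_finsetSum (f := fun i x => g (T^[i] x)) _ fun i _ =>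
    ((hT.iterate i).integrable_comp hg.1).2 hg]
  have h : ∀ i, ∫ x, g (T^[i] x) ∂μ = ∫ x, g x ∂μ := fun i => by
    have h1 := (hT.iterate i).map_eq
    conv_rhs => rw [← h1]
    rw [integral_map (hT.iterate i).measurable.aemeasurable (by rw [h1]; exact hg.1)]
  simp [h]

namespace IsBoundedSubadditive

variable {Ω : Type*} [MeasurableSpace Ω] {T : Ω → Ω} {C : ℝ} {f : ℕ → Ω → ℝ}

theorem const_nonneg [Nonempty Ω] (hf : IsBoundedSubadditive T C f) : 0 ≤ C := by
  obtain ⟨x⟩ := ‹Nonempty Ω›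
  simpa using (hf.nonneg 1 x).trans (hf.le 1 x)

theorem integrable (hf : IsBoundedSubadditive T C f) {μ : Measure Ω} [IsFiniteMeasure μ] (n : ℕ) :
    Integrable (f n) μ :=
  .of_bound (hf.measurable n).aestronglyMeasurable (C * n) (ae_of_all _ fun x => by
    rw [Real.norm_of_nonneg (hf.nonneg n x)]
    exact hf.le n x)

theorem succ_le (hf : IsBoundedSubadditive T C f) (n : ℕ) (x : Ω) :
    f (n + 1) x ≤ C + f n (T x) := by
  have h1 := hf.add_le 1 n x
  have h2 := hf.le 1 x
  rw [add_comm 1 n] at h1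
  simp only [Function.iterate_one, Nat.cast_one, mul_one] at h1 h2
  linarith

/-- Greedy decomposition of `[0, n)`: a point outside `B` starts a block of length `k ≤ M` on which
the process is at most `b * k`; a point of `B` is a block of length one and costs at most `C`; the
last, incomplete block costs at most `C * M`. -/
theorem le_birkhoffSum_indicator (hf : IsBoundedSubadditive T C f) {b : ℝ} (hb : 0 ≤ b) {M : ℕ}
    {B : Set Ω} (hB : ∀ x ∉ B, ∃ k, 1 ≤ k ∧ k ≤ M ∧ f k x ≤ b * k) (n : ℕ) (x : Ω) :
    f n x ≤ b * n + birkhoffSum T (B.indicator fun _ => C) n x + C * M := by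
  have hC : 0 ≤ C := by have : Nonempty Ω := ⟨x⟩; exact hf.const_nonneg
  have hI : ∀ y, 0 ≤ B.indicator (fun _ => C) y := fun y => Set.indicator_nonneg (fun _ _ => hC) y
  have hS : ∀ m y, 0 ≤ birkhoffSum T (B.indicator fun _ => C) m y := fun m y =>
    Finset.sum_nonneg fun _ _ => hI _
  induction n using Nat.strong_induction_on generalizing x with
  | _ n ih =>
    rcases n with _ | n
    · have h0 := hf.le 0 x
      have := mul_nonneg hC (Nat.cast_nonneg (α := ℝ) M)
      simp only [Nat.cast_zero, mul_zero, birkhoffSum_zero] at h0 ⊢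
      linarith
    by_cases hx : x ∈ B
    · have h1 := ih n n.lt_succ_self (T x)
      have h2 := hf.succ_le n x
      rw [birkhoffSum_succ', Set.indicator_of_mem hx]
      push_cast
      linarith
    · obtain ⟨k, hk1, hkM, hk⟩ := hB x hx
      by_cases hkn : k ≤ n + 1
      · obtain ⟨m, hm⟩ := Nat.exists_eq_add_of_le hkn
        have h1 := ih m (by omega) (T^[k] x)
        have h2 := hf.add_le k m x
        have h3 := hS k x
        rw [hm, birkhoffSum_add]
        push_cast
        linarith
      · have h1 := hf.le (n + 1) x
        have h2 : C * ((n + 1 : ℕ) : ℝ) ≤ C * M :=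
          mul_le_mul_of_nonneg_left (by exact_mod_cast (by omega : n + 1 ≤ M)) hC
        have h3 := hS (n + 1) x
        have h4 : 0 ≤ b * ((n + 1 : ℕ) : ℝ) := by positivity
        linarith

/-- If at almost every starting point the process is at most `b * n` at some time `n ≥ 1`, then its
mean growth rate is at most `b`. The set `B M` of points at which no such time is at most `M` has
small measure for large `M`, so the greedy decomposition with `B M` loses little on average. -/
theorem rate_le_of_ae_exists (hf : IsBoundedSubadditive T C f) {μ : Measure Ω}
    [IsProbabilityMeasure μ] (hT : MeasurePreserving T μ μ) {γ b : ℝ} (hb : 0 ≤ b)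
    (hγ : ∀ n : ℕ, γ * n ≤ ∫ x, f n x ∂μ) (h : ∀ᵐ x ∂μ, ∃ n, 1 ≤ n ∧ f n x ≤ b * n) : γ ≤ b := by
  have : Nonempty Ω := nonempty_of_isProbabilityMeasure μ
  let B : ℕ → Set Ω := fun M => {x | ∀ k, 1 ≤ k → k ≤ M → b * k < f k x}
  have hBm : ∀ M, MeasurableSet (B M) := fun M => by
    simp only [B, Set.ofPred_forall]
    exact .iInter fun k => .iInter fun _ => .iInter fun _ =>
      measurableSet_lt measurable_const (hf.measurable k)
  have key : ∀ M, γ ≤ b + C * μ.real (B M) := by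
    intro M
    have h1 : ∀ n : ℕ, γ * n ≤ (b + C * μ.real (B M)) * n + C * M := by
      intro n
      have hI : Integrable ((B M).indicator fun _ => C) μ :=
        (integrable_const C).indicator (hBm M)
      have hS : Integrable (birkhoffSum T ((B M).indicator fun _ => C) n) μ := by
        unfold birkhoffSum
        exact integrable_finsetSum _ fun i _ => ((hT.iterate i).integrable_comp hI.1).2 hI
      have h2 : ∫ x, f n x ∂μ ≤
          ∫ x, b * n + birkhoffSum T ((B M).indicator fun _ => C) n x + C * M ∂μ := by
        refine integral_mono (hf.integrable n)
          (((integrable_const _).add hS).add (integrable_const _)) fun x => ?_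
        refine hf.le_birkhoffSum_indicator hb (fun x hx => ?_) n x
        simpa [B] using hx
      rw [integral_add (f := fun x => b * n + birkhoffSum T ((B M).indicator fun _ => C) n x)
          ((integrable_const _).add hS) (integrable_const _), integral_add (integrable_const _) hS, integral_birkhoffSum hT hI,
        integral_indicator_const _ (hBm M)] at h2
      simp only [integral_const, probReal_univ, smul_eq_mul, one_mul] at h2
      have := hγ n
      linarith
    by_contra! h2
    obtain ⟨n, hn⟩ := exists_nat_gt (C * M / (γ - (b + C * μ.real (B M))))
    rw [div_lt_iff₀ (by linarith)] at hn
    have := h1 n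
    linarith
  have hlim : Tendsto (fun M => b + C * μ.real (B M)) atTop (𝓝 (b + C * 0)) := by
    refine tendsto_const_nhds.add (tendsto_const_nhds.mul ?_)
    have h0 : μ (⋂ M, B M) = 0 := by
      refine measure_mono_null (fun x hx => ?_) h
      rintro ⟨n, hn1, hn⟩
      exact absurd (Set.mem_iInter.1 hx n n hn1 le_rfl) (not_lt.2 hn)
    have h1 := tendsto_measure_iInter_atTop (μ := μ) (s := B)
      (fun M => (hBm M).nullMeasurableSet)
      (fun M N hMN x hx k hk1 hk => hx k hk1 (hk.trans hMN)) ⟨0, measure_ne_top _ _⟩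
    rw [h0] at h1
    exact (ENNReal.tendsto_toReal ENNReal.zero_ne_top).comp h1
  simpa using ge_of_tendsto' hlim key

/-- The lower bound in the subadditive ergodic theorem. By ergodicity, otherwise almost every orbit
would have times `n` at which the process is at most `b * n`, for some `b < γ`. -/
theorem ae_eventually_lt (hf : IsBoundedSubadditive T C f) {μ : Measure Ω}
    [IsProbabilityMeasure μ] (hT : Ergodic T μ) {γ : ℝ}
    (hγ : ∀ n : ℕ, γ * n ≤ ∫ x, f n x ∂μ) {b' : ℝ} (hb' : b' < γ) :
    ∀ᵐ x ∂μ, ∀ᶠ n : ℕ in atTop, b' < f n x / n := by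
  rcases lt_or_ge b' 0 with h0 | h0
  · exact ae_of_all _ fun x => .of_forall fun n =>
      h0.trans_le (div_nonneg (hf.nonneg n x) n.cast_nonneg)
  obtain ⟨b, hb1, hb2⟩ := exists_between hb'
  have hb0 : 0 ≤ b := h0.trans hb1.le
  -- Allowing for an arbitrary additive constant `K` absorbs the first step, so that `T ⁻¹' A ⊆ A`.
  let A : Set Ω := {x | ∀ K N : ℕ, ∃ n, N ≤ n ∧ f n x + K ≤ b * n}
  have hAm : MeasurableSet A := by
    simp only [A, Set.ofPred_forall, Set.ofPred_exists, Set.ofPred_and]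
    exact .iInter fun K => .iInter fun N => .iUnion fun n => .inter (.const _)
      (measurableSet_le ((hf.measurable n).add_const _) measurable_const)
  have hAT : T ⁻¹' A ⊆ A := by
    intro x hx K N
    obtain ⟨L, hL⟩ := exists_nat_ge (K + C)
    obtain ⟨n, hn, hn'⟩ := hx L N
    refine ⟨n + 1, by omega, ?_⟩
    have := hf.succ_le n x
    push_cast
    linarith
  rcases hT.ae_empty_or_univ_of_preimage_ae_le hAm.nullMeasurableSet
    (LE.le.eventuallyLE hAT) with h | h
  · filter_upwards [h] with x hx
    have hx : ¬ ∀ K N : ℕ, ∃ n, N ≤ n ∧ f n x + K ≤ b * n := fun hA => (iff_of_eq hx).1 hA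
    push Not at hx
    obtain ⟨K, N, hK⟩ := hx
    obtain ⟨m, hm⟩ := exists_nat_gt (K / (b - b'))
    filter_upwards [eventually_ge_atTop N, eventually_ge_atTop m, eventually_gt_atTop 0]
      with n hN hmn hn
    have h1 := hK n hN
    have hn' : (0 : ℝ) < n := by exact_mod_cast hn
    have hmn' : (m : ℝ) ≤ n := by exact_mod_cast hmn
    have h2 := hm.trans_le hmn'
    rw [div_lt_iff₀ (by linarith)] at h2
    rw [lt_div_iff₀ hn']
    linarith
  · refine absurd (hf.rate_le_of_ae_exists hT.toMeasurePreserving hb0 hγ ?_) (not_le.2 hb2)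
    filter_upwards [h] with x hx
    have hx : x ∈ A := (iff_of_eq hx).2 trivial
    obtain ⟨n, hn, hn'⟩ := hx 0 1
    exact ⟨n, hn, by simpa using hn'⟩

theorem birkhoffSum_of_bounded {K : ℝ} {g : Ω → ℝ} (hT : Measurable T) (hg : Measurable g)
    (h0 : ∀ x, 0 ≤ g x) (hK : ∀ x, g x ≤ K) :
    IsBoundedSubadditive T K fun n => birkhoffSum T g n where
  measurable n := Finset.measurable_sum _ fun i _ => hg.comp (hT.iterate i)
  nonneg n x := Finset.sum_nonneg fun i _ => h0 _
  le n x := by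
    refine (Finset.sum_le_sum fun i _ => hK _).trans ?_
    simp [mul_comm]
  add_le m n x := (birkhoffSum_add T g m n x).le

/-- The upper bound in Birkhoff's ergodic theorem, obtained from the lower bound for the sums of
`K - g`. -/
theorem ae_eventually_birkhoffSum_lt {μ : Measure Ω} [IsProbabilityMeasure μ] (hT : Ergodic T μ)
    {K : ℝ} {g : Ω → ℝ} (hg : Measurable g) (h0 : ∀ x, 0 ≤ g x) (hK : ∀ x, g x ≤ K) {b : ℝ}
    (hb : ∫ x, g x ∂μ < b) : ∀ᵐ x ∂μ, ∀ᶠ n : ℕ in atTop, birkhoffSum T g n x / n < b := by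
  have hgi : Integrable g μ := .of_bound hg.aestronglyMeasurable K (ae_of_all _ fun x => by
    rw [Real.norm_of_nonneg (h0 x)]; exact hK x)
  have hf := birkhoffSum_of_bounded (g := fun x => K - g x) hT.measurable (hg.const_sub K)
    (fun x => sub_nonneg.2 (hK x)) (fun x => sub_le_self K (h0 x))
  have hγ : ∀ n : ℕ, (K - ∫ x, g x ∂μ) * n ≤ ∫ x, birkhoffSum T (fun x => K - g x) n x ∂μ := by
    intro n
    rw [integral_birkhoffSum (g := fun x => K - g x) hT.toMeasurePreserving ((integrable_const K).sub hgi),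
      integral_sub (integrable_const K) hgi]
    simp [mul_comm]
  filter_upwards [hf.ae_eventually_lt hT hγ (b' := K - b) (by linarith)] with x hx
  filter_upwards [hx, eventually_gt_atTop 0] with n hn hn0
  have hn0' : (0 : ℝ) < n := by exact_mod_cast hn0
  rw [lt_div_iff₀ hn0'] at hn
  rw [div_lt_iff₀ hn0']
  simp only [birkhoffSum, Finset.sum_sub_distrib, Finset.sum_const, Finset.card_range,
    nsmul_eq_mul] at hn ⊢
  linarith

/-- Summing the decompositions of `[0, n)` into blocks of length `m` over the `m` possible starting
points replaces the map `T^[m]`, which need not be ergodic, by `T`. -/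
theorem sum_iterate_le_birkhoffSum (hf : IsBoundedSubadditive T C f) (m : ℕ) (hm : 1 ≤ m) (n : ℕ)
    (x : Ω) : ∑ j ∈ Finset.range m, f n (T^[j] x) ≤ birkhoffSum T (f m) n x + C * m ^ 2 := by
  have hC : 0 ≤ C := by have : Nonempty Ω := ⟨x⟩; exact hf.const_nonneg
  induction n using Nat.strong_induction_on generalizing x with
  | _ n ih =>
    by_cases hn : n < m
    · have h1 : ∑ j ∈ Finset.range m, f n (T^[j] x) ≤ ∑ j ∈ Finset.range m, C * m :=
        Finset.sum_le_sum fun j _ => (hf.le _ _).trans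
          (mul_le_mul_of_nonneg_left (by exact_mod_cast hn.le) hC)
      have h2 : 0 ≤ birkhoffSum T (f m) n x := Finset.sum_nonneg fun _ _ => hf.nonneg _ _
      simp only [Finset.sum_const, Finset.card_range, nsmul_eq_mul] at h1
      nlinarith
    · obtain ⟨k, rfl⟩ := Nat.exists_eq_add_of_le (not_lt.1 hn)
      have h1 := ih k (by omega) (T^[m] x)
      have h2 : ∑ j ∈ Finset.range m, f (m + k) (T^[j] x) ≤
          ∑ j ∈ Finset.range m, (f m (T^[j] x) + f k (T^[j] (T^[m] x))) := by
        refine Finset.sum_le_sum fun j _ => ?_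
        rw [← Function.iterate_add_apply, add_comm j m, Function.iterate_add_apply]
        exact hf.add_le m k _
      rw [Finset.sum_add_distrib] at h2
      rw [birkhoffSum_add]
      simp only [birkhoffSum] at h1 ⊢
      linarith

theorem mul_le_birkhoffSum (hf : IsBoundedSubadditive T C f) (m : ℕ) (hm : 1 ≤ m) (n : ℕ)
    (x : Ω) : m * f (n + m) x ≤ birkhoffSum T (f m) n x + 2 * C * m ^ 2 := by
  have h1 : ∑ j ∈ Finset.range m, f (n + m) x ≤
      ∑ j ∈ Finset.range m, (C * m + f n (T^[j] x)) := by
    refine Finset.sum_le_sum fun j hj => ?_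
    obtain ⟨k, rfl⟩ := Nat.exists_eq_add_of_le (Finset.mem_range.1 hj).le
    have h2 := hf.add_le j (n + k) x
    have h3 := hf.add_le n k (T^[j] x)
    have h4 := hf.le j x
    have h5 := hf.le k (T^[n] (T^[j] x))
    rw [show n + (j + k) = j + (n + k) by ring]
    push_cast
    linarith
  rw [Finset.sum_add_distrib] at h1
  simp only [Finset.sum_const, Finset.card_range, nsmul_eq_mul] at h1
  have h2 := hf.sum_iterate_le_birkhoffSum m hm n x
  nlinarith

/-- The upper bound in the subadditive ergodic theorem, from Birkhoff's theorem for `f m`. -/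
theorem ae_eventually_gt (hf : IsBoundedSubadditive T C f) {μ : Measure Ω}
    [IsProbabilityMeasure μ] (hT : Ergodic T μ) {m : ℕ} (hm : 1 ≤ m) {b : ℝ}
    (hb : (∫ x, f m x ∂μ) / m < b) : ∀ᵐ x ∂μ, ∀ᶠ n : ℕ in atTop, f n x / n < b := by
  have : Nonempty Ω := nonempty_of_isProbabilityMeasure μ
  have hC := hf.const_nonneg
  have hm' : (0 : ℝ) < m := by exact_mod_cast hm
  rw [div_lt_iff₀ hm'] at hb
  obtain ⟨c, hc1, hc2⟩ := exists_between hb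
  have hc0 : 0 ≤ c := (integral_nonneg (hf.nonneg m)).trans hc1.le
  filter_upwards [ae_eventually_birkhoffSum_lt hT (hf.measurable m) (hf.nonneg m) (hf.le m) hc1]
    with x hx
  obtain ⟨L, hL⟩ := exists_nat_gt (2 * C * m ^ 2 / (b * m - c))
  rw [div_lt_iff₀ (by linarith)] at hL
  refine (eventually_atTop.1 ((hx.and (eventually_gt_atTop L)))).elim fun N hN =>
    eventually_atTop.2 ⟨N + m, fun n hn => ?_⟩
  obtain ⟨k, rfl⟩ := Nat.exists_eq_add_of_le' (show m ≤ n by omega)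
  obtain ⟨h1, h2⟩ := hN k (by omega)
  have hk : (0 : ℝ) < k := by exact_mod_cast (by omega : 0 < k)
  have h2' : (L : ℝ) < k := by exact_mod_cast h2
  rw [div_lt_iff₀ hk] at h1
  have h3 := hf.mul_le_birkhoffSum m hm k x
  push_cast
  rw [div_lt_iff₀ (by positivity)]
  have h4 : L * (b * m - c) ≤ k * (b * m - c) :=
    mul_le_mul_of_nonneg_right h2'.le (by linarith)
  have h5 : m * f (k + m) x < m * (b * (k + m)) := by
    have hb0 : 0 ≤ b := by
      by_contra! hneg
      nlinarith
    have : 0 ≤ m * (b * m) := by positivity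
    nlinarith
  exact lt_of_mul_lt_mul_left h5 hm'.le

theorem subadditive_integral (hf : IsBoundedSubadditive T C f) {μ : Measure Ω}
    [IsProbabilityMeasure μ] (hT : MeasurePreserving T μ μ) :
    Subadditive fun n => ∫ x, f n x ∂μ := by
  intro m n
  have hi : Integrable (fun x => f n (T^[m] x)) μ :=
    ((hT.iterate m).integrable_comp (hf.integrable n).1).2 (hf.integrable n)
  refine (integral_mono (hf.integrable (m + n)) ((hf.integrable m).add hi)
    (hf.add_le m n)).trans ?_
  simp only [Pi.add_apply]
  rw [integral_add (hf.integrable m) hi]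
  have h1 := (hT.iterate m).map_eq
  conv_rhs => rw [← h1]
  rw [integral_map (hT.iterate m).measurable.aemeasurable (hf.measurable n).aestronglyMeasurable,
    h1]

/-- The subadditive ergodic theorem for a bounded process over an ergodic transformation: the limit
is the mean growth rate. -/
theorem exists_ae_tendsto (hf : IsBoundedSubadditive T C f) {μ : Measure Ω}
    [IsProbabilityMeasure μ] (hT : Ergodic T μ) :
    ∃ γ : ℝ, 0 ≤ γ ∧ Tendsto (fun n : ℕ => (∫ x, f n x ∂μ) / n) atTop (𝓝 γ) ∧
      ∀ᵐ x ∂μ, Tendsto (fun n : ℕ => f n x / n) atTop (𝓝 γ) := by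
  have hs := hf.subadditive_integral hT.toMeasurePreserving
  have h0 : ∀ n : ℕ, 0 ≤ (∫ x, f n x ∂μ) / n := fun n =>
    div_nonneg (integral_nonneg (hf.nonneg n)) n.cast_nonneg
  have hbdd : BddBelow (Set.range fun n : ℕ => (∫ x, f n x ∂μ) / n) :=
    ⟨0, by rintro _ ⟨n, rfl⟩; exact h0 n⟩
  have hlim := hs.tendsto_lim hbdd
  refine ⟨hs.lim, ge_of_tendsto' hlim h0, hlim, ae_tendsto_of_forall_eventually_lt
    (fun b hb => hf.ae_eventually_lt hT (fun n => ?_) hb) fun b hb => ?_⟩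
  · rcases n.eq_zero_or_pos with rfl | hn
    · simpa using integral_nonneg (hf.nonneg 0)
    · exact (le_div_iff₀ (by exact_mod_cast hn)).1 (hs.lim_le_div hbdd hn.ne')
  · obtain ⟨m, hm, hm1⟩ := ((hlim.eventually_lt_const hb).and (eventually_ge_atTop 1)).exists
    exact hf.ae_eventually_gt hT hm1 hm

end IsBoundedSubadditive

/-- A uniformly bounded sequence converging almost surely converges in `L¹`. -/
theorem tendsto_eLpNorm_one_of_bounded {Ω : Type*} [MeasurableSpace Ω] {μ : Measure Ω}
    [IsFiniteMeasure μ] {u : ℕ → Ω → ℝ} {γ K : ℝ} (hu : ∀ n, Measurable (u n))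
    (hK : ∀ n x, |u n x| ≤ K) (h : ∀ᵐ x ∂μ, Tendsto (fun n => u n x) atTop (𝓝 γ)) :
    Tendsto (fun n => eLpNorm (fun x => u n x - γ) 1 μ) atTop (𝓝 0) := by
  simp only [eLpNorm_one_eq_lintegral_enorm, ← ofReal_norm]
  exact tendsto_lintegral_norm_of_dominated_convergence (F := u) (f := fun _ => γ)
    (bound := fun _ => K) (fun n => (hu n).aestronglyMeasurable)
    (integrable_const K).hasFiniteIntegral (fun n => ae_of_all _ (hK n)) h

/-! ### The shift preserves the law of the walk -/

/-- Finite measures on a sequence space which agree on the cylinders of length `r` agree on all sets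
that depend on the first coordinates only. -/
theorem measure_eq_of_cylinder_eq {V : Type*} [MeasurableSpace V] [DiscreteMeasurableSpace V]
    [Countable V] {μ ν : Measure (ℕ → V)} (r : ℕ)
    (h : ∀ q : ℕ → V, μ {x | ∀ i ≤ r, x i = q i} = ν {x | ∀ i ≤ r, x i = q i})
    {S : Set (ℕ → V)} (hS : ∀ x ∈ S, ∀ y, (∀ i ≤ r, y i = x i) → y ∈ S) : μ S = ν S := by
  let F : (ℕ → V) → (Finset.Iic r → V) := fun x i => x i
  have hF : Measurable F := measurable_pi_lambda _ fun i => measurable_pi_apply _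
  have hSF : S = F ⁻¹' (F '' S) := by
    refine Set.Subset.antisymm (Set.subset_preimage_image _ _) ?_
    rintro y ⟨x, hx, hxy⟩
    exact hS x hx y fun i hi => (congrFun hxy ⟨i, Finset.mem_Iic.2 hi⟩).symm
  have hmap : μ.map F = ν.map F := by
    refine Measure.ext_of_singleton fun p => ?_
    rw [Measure.map_apply hF (measurableSet_singleton p),
      Measure.map_apply hF (measurableSet_singleton p)]
    rcases (F ⁻¹' {p}).eq_empty_or_nonempty with h0 | ⟨q, rfl⟩
    · rw [h0, measure_empty, measure_empty]
    · have : F ⁻¹' {F q} = {x | ∀ i ≤ r, x i = q i} := by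
        ext x
        simp [F, funext_iff]
      rw [this, h q]
  rw [hSF, ← Measure.map_apply hF .of_discrete, hmap, Measure.map_apply hF .of_discrete]

namespace LFGraph

/-- The Markov property of simple random walk at time one. -/
theorem walkMeasure_shift (G : LFGraph) (v : G.V) (r : ℕ) {S : Set (ℕ → G.V)}
    (hS : ∀ x ∈ S, ∀ y, (∀ i ≤ r, y i = x i) → y ∈ S) :
    G.walkMeasure v {x | (fun n => x (n + 1)) ∈ S} =
      ∫⁻ x, G.walkMeasure (x 1) S ∂G.walkMeasure v := by
  have hsh : Measurable fun (x : ℕ → G.V) n => x (n + 1) :=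
    measurable_pi_lambda _ fun n => measurable_pi_apply _
  have hk : Measurable fun x : ℕ → G.V => G.walkMeasure (x 1) :=
    (Measurable.of_discrete (f := G.walkMeasure)).comp (measurable_pi_apply 1)
  have hSm := measurableSet_of_finite_dep r S hS
  rw [← Measure.bind_apply hSm hk.aemeasurable]
  refine (Measure.map_apply hsh hSm).symm.trans (measure_eq_of_cylinder_eq r (fun q => ?_) hS)
  have hq : MeasurableSet {x : ℕ → G.V | ∀ i ≤ r, x i = q i} :=
    measurableSet_of_finite_dep r _ fun x hx y hy i hi => (hy i hi).trans (hx i hi)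
  have h1 : ∀ x : ℕ → G.V, G.walkMeasure (x 1) {y | ∀ i ≤ r, y i = q i} =
      Set.indicator {x : ℕ → G.V | x 1 = q 0}
        (fun _ => G.walkMeasure (q 0) {y | ∀ i ≤ r, y i = q i}) x := by
    intro x
    by_cases hx : x 1 = q 0
    · rw [Set.indicator_of_mem (by exact hx), hx]
    · rw [Set.indicator_of_notMem (by exact hx)]
      exact G.walkMeasure_cylinder_zero _ _ _ fun h => hx h.1.symm
  have hm1 : MeasurableSet {x : ℕ → G.V | x 1 = q 0} :=
    measurableSet_eq_fun (measurable_pi_apply 1) measurable_const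
  rw [Measure.bind_apply hq hk.aemeasurable, Measure.map_apply hsh hq]
  simp_rw [h1]
  rw [lintegral_indicator_const hm1, walkMeasure_cylinder]
  -- Both sides are products of transition probabilities along `v, q 0, …, q r`.
  let p : ℕ → G.V := fun n => Nat.casesOn n v q
  have e1 : G.walkMeasure v ((fun (x : ℕ → G.V) n => x (n + 1)) ⁻¹' {x | ∀ i ≤ r, x i = q i}) =
      G.walkMeasure (p 0) {x | ∀ i ≤ r + 1, x i = p i} := by
    refine measure_congr ?_
    filter_upwards [G.ae_walkMeasure v] with x hx
    refine propext ⟨fun h i hi => ?_, fun h i hi => h (i + 1) (Nat.succ_le_succ hi)⟩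
    cases i with
    | zero => exact hx.1
    | succ i => exact h i (Nat.le_of_succ_le_succ hi)
  have e2 : G.walkMeasure v {x | x 1 = q 0} =
      G.walkMeasure (p 0) {x | ∀ i ≤ 1, x i = p i} := by
    refine measure_congr ?_
    filter_upwards [G.ae_walkMeasure v] with x hx
    refine propext ⟨fun h i hi => ?_, fun h => h 1 le_rfl⟩
    interval_cases i
    · exact hx.1
    · exact h
  rw [e1, e2, walkMeasure_cylinder, walkMeasure_cylinder, Finset.prod_range_succ', mul_comm]
  simp [p, mul_comm]

end LFGraph

namespace PathGraph

theorem measurableSet_cell (r : ℕ) (p : PathGraph) : MeasurableSet {b | Level r p b} := by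
  rw [generateFrom_cells]
  exact MeasurableSpace.measurableSet_generateFrom ⟨r, _, rfl⟩

end PathGraph

theorem RootedLFGraph.walkLaw_apply (A : RootedLFGraph) {S : Set PathGraph}
    (hS : MeasurableSet S) {U : Set (ℕ → A.V)}
    (h : ∀ x hx, PathGraph.mk ⟨A.toLFGraph, x, hx⟩ ∈ S ↔ x ∈ U) :
    A.walkLaw S = A.walkMeasure A.root U := by
  rw [walkLaw, Measure.map_apply A.measurable_mk hS]
  refine (comap_subtype_coe_apply A.measurableSet_isPath (A.walkMeasure A.root) _).trans
    (measure_congr ?_)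
  filter_upwards [A.ae_walkMeasure A.root] with x hx
  refine propext ⟨?_, fun hU => ⟨⟨x, hx.2⟩, (h x hx.2).2 hU, rfl⟩⟩
  rintro ⟨y, hy, rfl⟩
  exact (h y.1 y.2).1 hy

theorem RootedLFGraph.lintegral_walkLaw (A : RootedLFGraph) {f : PathGraph → ENNReal}
    (hf : Measurable f) {g : (ℕ → A.V) → ENNReal}
    (h : ∀ x hx, f (PathGraph.mk ⟨A.toLFGraph, x, hx⟩) = g x) :
    ∫⁻ a, f a ∂A.walkLaw = ∫⁻ x, g x ∂A.walkMeasure A.root := by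
  rw [walkLaw, lintegral_map hf A.measurable_mk]
  have h1 := lintegral_subtype_comap A.measurableSet_isPath g (μ := A.walkMeasure A.root)
  have h2 : ∀ᵐ x ∂A.walkMeasure A.root, x ∈ {x | A.IsPath x} :=
    (A.ae_walkMeasure A.root).mono fun x hx => hx.2
  rw [Measure.restrict_eq_self_of_ae_mem h2] at h1
  rw [← h1]
  exact lintegral_congr fun x => h x.1 x.2

/-- The Markov property: given `(G, X_0, X_1)`, the shifted walk is a simple random walk on
`(G, X_1)`. -/
theorem RootedLFGraph.map_shift_walkLaw (A : RootedLFGraph) :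
    A.walkLaw.map PathGraph.shift = A.walkLaw.bind fun a => walkKernel (a.rootAt 1) := by
  have hk : Measurable fun a : PathGraph => walkKernel (a.rootAt 1) :=
    walkKernel.measurable.comp (PathGraph.measurable_rootAt 1)
  have : IsProbabilityMeasure (A.walkLaw.map PathGraph.shift) :=
    Measure.isProbabilityMeasure_map PathGraph.measurable_shift.aemeasurable
  refine ext_of_generate_finite _ PathGraph.generateFrom_cells PathGraph.isLevels.isPiSystem_cells
    ?_ ?_
  · rintro _ ⟨r, p, rfl⟩
    have hS := PathGraph.measurableSet_cell r p
    rw [Measure.map_apply PathGraph.measurable_shift hS, Measure.bind_apply hS hk.aemeasurable]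
    induction p using PathGraph.ind with
    | h P =>
      let S : Set (ℕ → A.V) := {x | LFGraph.BallIso r A.toLFGraph x P.toLFGraph P.path}
      have h1 : A.walkLaw (PathGraph.shift ⁻¹' {b | PathGraph.Level r (PathGraph.mk P) b}) =
          A.walkMeasure A.root {x | (fun n => x (n + 1)) ∈ S} := by
        refine A.walkLaw_apply (PathGraph.measurable_shift hS) fun x hx => ?_
        change PathGraph.Level r (PathGraph.mk P)
          (PathGraph.mk ⟨A.toLFGraph, fun n => x (n + 1), fun n => hx (n + 1)⟩) ↔
          LFGraph.BallIso r A.toLFGraph (fun n => x (n + 1)) P.toLFGraph P.path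
        rw [PathGraph.level_mk]
        exact ⟨fun h => h.symm, fun h => h.symm⟩
      have h2 : ∫⁻ a, walkKernel (a.rootAt 1) {b | PathGraph.Level r (PathGraph.mk P) b}
          ∂A.walkLaw = ∫⁻ x, A.walkMeasure (x 1) S ∂A.walkMeasure A.root := by
        refine A.lintegral_walkLaw (walkKernel.measurable_coe hS |>.comp
          (PathGraph.measurable_rootAt 1)) fun x hx => ?_
        exact RootedLFGraph.walkLaw_cell ⟨A.toLFGraph, x 1⟩ r P
      rw [h1, h2]
      exact A.walkMeasure_shift A.root r fun x hx y hy => (LFGraph.BallIso.congr hy).symm.trans hx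
  · rw [measure_univ, Measure.bind_apply .univ hk.aemeasurable]
    simp

instance (P : Measure RootedGraph) [IsProbabilityMeasure P] :
    IsProbabilityMeasure (walkLaw P) := by
  unfold walkLaw; infer_instance

theorem IsStationaryRandomGraph.measurePreserving_shift {P : Measure RootedGraph}
    (hstat : IsStationaryRandomGraph P) :
    MeasurePreserving PathGraph.shift (walkLaw P) (walkLaw P) := by
  have hk : Measurable fun a : PathGraph => walkKernel (a.rootAt 1) :=
    walkKernel.measurable.comp (PathGraph.measurable_rootAt 1)
  refine ⟨PathGraph.measurable_shift, Measure.ext fun S hS => ?_⟩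
  have h1 : ∀ g, walkKernel g (PathGraph.shift ⁻¹' S) =
      ∫⁻ a, walkKernel (a.rootAt 1) S ∂walkKernel g := by
    intro g
    induction g using RootedGraph.ind with
    | h A =>
      rw [← Measure.bind_apply hS hk.aemeasurable, ← Measure.map_apply PathGraph.measurable_shift hS]
      exact congrArg (fun μ : Measure PathGraph => μ S) A.map_shift_walkLaw
  have hkS : Measurable fun g => walkKernel g S := walkKernel.measurable_coe hS
  have h2 : walkLaw P S = ∫⁻ g, walkKernel g S ∂P :=
    Measure.bind_apply hS walkKernel.aemeasurable
  rw [Measure.map_apply PathGraph.measurable_shift hS, walkLaw,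
    Measure.bind_apply (PathGraph.measurable_shift hS) walkKernel.aemeasurable]
  simp_rw [h1]
  rw [← Measure.lintegral_bind (f := fun a => walkKernel (a.rootAt 1) S) walkKernel.aemeasurable
      (hkS.comp (PathGraph.measurable_rootAt 1)).aemeasurable]
  change _ = walkLaw P S
  rw [h2]
  conv_rhs => rw [← hstat 1 le_rfl]
  rw [lintegral_map hkS (PathGraph.measurable_rootAt 1)]
  rfl

/-! ### The range and the distance as subadditive processes -/

namespace LFGraph

theorem IsPath.mem_ball {G : LFGraph} {x : ℕ → G.V} (hx : G.IsPath x) {n r : ℕ} (h : n ≤ r) :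
    x n ∈ G.ball (x 0) r :=
  (G.dist_le_of_step x n fun i _ => hx i).trans h

theorem BallIso.dist_le {r n : ℕ} {G H : LFGraph} {x : ℕ → G.V} {y : ℕ → H.V} (hx : G.IsPath x)
    (h : BallIso r G x H y) (hn : n ≤ r) : H.graph.dist (y 0) (y n) ≤ G.graph.dist (x 0) (x n) := by
  obtain ⟨e, he⟩ := h
  have h1 := ballIso_dist_le e ⟨x 0, G.mem_ball_self _ _⟩ (G.graph.dist (x 0) (x n))
    (by simpa using show G.graph.dist (x 0) (x n) ≤ r from hx.mem_ball hn) ⟨x n, hx.mem_ball hn⟩ le_rfl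
  rwa [(he 0 (Nat.zero_le _) _).2 rfl, (he n hn _).2 rfl] at h1

theorem BallIso.path_eq_iff {r i j : ℕ} {G H : LFGraph} {x : ℕ → G.V} {y : ℕ → H.V}
    (hx : G.IsPath x) (h : BallIso r G x H y) (hi : i ≤ r) (hj : j ≤ r) :
    y j = y i ↔ x j = x i := by
  obtain ⟨e, he⟩ := h
  rw [← he i hi ⟨x j, hx.mem_ball hj⟩, (he j hj _).2 rfl]

end LFGraph

namespace PathGraph

theorem iterate_shift_mk (A : PathLFGraph) (m : ℕ) : shift^[m] (mk A) =
    mk ⟨A.toLFGraph, fun n => A.path (n + m), fun n => by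
      have := A.isPath (n + m)
      rwa [show n + m + 1 = n + 1 + m by omega] at this⟩ := by
  induction m with
  | zero => rfl
  | succ m ih =>
    rw [Function.iterate_succ_apply', ih]
    change mk _ = mk _
    simp only [show ∀ n, n + 1 + m = n + (m + 1) from fun n => by omega]

/-- A function that is locally constant for the local distance is measurable. -/
theorem measurable_of_level {β : Type*} [MeasurableSpace β] {f : PathGraph → β} (r : ℕ)
    (h : ∀ a b, Level r a b → f a = f b) : Measurable f := by
  intro U _
  refine ((isLevels.isOpen_iff_level _).2 fun a ha => ⟨r, fun b hb => ?_⟩).measurableSet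
  rwa [Set.mem_preimage, ← h a b hb]

theorem measurable_dist (n : ℕ) : Measurable (dist n) := by
  refine measurable_of_level n fun a b h => ?_
  induction a using ind with
  | h A =>
    induction b using ind with
    | h B =>
      have h1 := LFGraph.BallIso.dist_le A.isPath h le_rfl
      have h2 := LFGraph.BallIso.dist_le B.isPath (LFGraph.BallIso.symm h) le_rfl
      exact h2.antisymm h1

theorem dist_le (n : ℕ) (a : PathGraph) : dist n a ≤ n := by
  induction a using ind with
  | h A => exact A.dist_le_of_step A.path n fun i _ => A.isPath i

theorem dist_add_le (m n : ℕ) (a : PathGraph) :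
    dist (m + n) a ≤ dist m a + dist n (shift^[m] a) := by
  induction a using ind with
  | h A =>
    rw [iterate_shift_mk]
    have := A.connected.dist_triangle (u := A.path 0) (v := A.path m) (w := A.path (m + n))
    change A.graph.dist _ _ ≤ A.graph.dist _ _ + A.graph.dist (A.path (0 + m)) (A.path (n + m))
    rwa [zero_add, add_comm n m]

theorem isBoundedSubadditive_dist :
    IsBoundedSubadditive shift 1 fun n a => (dist n a : ℝ) where
  measurable n := measurable_from_nat.comp (measurable_dist n)
  nonneg n a := Nat.cast_nonneg _
  le n a := by rw [one_mul]; exact_mod_cast dist_le n a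
  add_le m n a := by exact_mod_cast dist_add_le m n a

/-- The number of vertices visited strictly before time `n`. Unlike the range at time `n`, it is
at most `n`, also for `n = 0`. -/
noncomputable def rangeBefore : ℕ → PathGraph → ℕ
  | 0, _ => 0
  | n + 1, a => range n a

theorem rangeBefore_mk (n : ℕ) (A : PathLFGraph) :
    rangeBefore n (mk A) = (A.path '' Set.Iio n).ncard := by
  cases n with
  | zero => simp [rangeBefore]
  | succ n =>
    change (A.path '' Set.Iic n).ncard = _
    congr 2
    ext i
    exact Nat.lt_succ_iff.symm

/-- The event that the path does not return to its starting point up to time `k`. -/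
def noReturnUpTo (k : ℕ) : Set PathGraph :=
  {a | Quotient.liftOn a (fun A => ∀ i ≥ 1, i ≤ k → A.path i ≠ A.path 0) fun A B ⟨e, he⟩ => by
    simp only [← he, ne_eq, e.injective.eq_iff]}

theorem mk_mem_noReturnUpTo (k : ℕ) (A : PathLFGraph) :
    mk A ∈ noReturnUpTo k ↔ ∀ i ≥ 1, i ≤ k → A.path i ≠ A.path 0 := Iff.rfl

theorem antitone_noReturnUpTo : Antitone noReturnUpTo := by
  intro k l hkl a ha
  induction a using ind with
  | h A => exact fun i hi hik => ha i hi (hik.trans hkl)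

theorem iInter_noReturnUpTo : ⋂ k, noReturnUpTo k = neverReturns := by
  ext a
  induction a using ind with
  | h A =>
    rw [Set.mem_iInter]
    exact ⟨fun h i hi => h i i hi le_rfl, fun h k i hi _ => h i hi⟩

theorem measurableSet_noReturnUpTo (k : ℕ) : MeasurableSet (noReturnUpTo k) := by
  have h : Measurable fun a => a ∈ noReturnUpTo k := by
    refine measurable_of_level k fun a b h => ?_
    induction a using ind with
    | h A =>
      induction b using ind with
      | h B =>
        rw [eq_iff_iff, mk_mem_noReturnUpTo, mk_mem_noReturnUpTo]
        refine forall₃_congr fun i _ hik => not_congr ?_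
        exact (LFGraph.BallIso.path_eq_iff A.isPath h (Nat.zero_le _) hik).symm
  exact measurableSet_setOfPred.2 h

/-- Each visited vertex is counted once, at its last visit before time `n + 1`. -/
theorem rangeBefore_succ (n : ℕ) (a : PathGraph) : (rangeBefore (n + 1) a : ℝ) =
    (noReturnUpTo n).indicator 1 a + rangeBefore n (shift a) := by
  classical
  induction a using ind with
  | h A =>
    have h2 : rangeBefore n (shift (mk A)) = (A.path '' Set.Ioo 0 (n + 1)).ncard := by
      refine (rangeBefore_mk n _).trans ?_
      change ((A.path ∘ Nat.succ) '' Set.Iio n).ncard = _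
      rw [Set.image_comp]
      congr 2
      ext i
      cases i <;> simp
    have h1 : A.path '' Set.Iio (n + 1) = insert (A.path 0) (A.path '' Set.Ioo 0 (n + 1)) := by
      rw [← Set.image_insert_eq]
      congr 1
      ext i
      simp only [Set.mem_Iio, Set.mem_insert_iff, Set.mem_Ioo]
      omega
    have hfin : (A.path '' Set.Ioo 0 (n + 1)).Finite := (Set.finite_Ioo 0 (n + 1)).image _
    have hmem : A.path 0 ∈ A.path '' Set.Ioo 0 (n + 1) ↔ mk A ∉ noReturnUpTo n := by
      rw [mk_mem_noReturnUpTo]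
      push Not
      exact ⟨fun ⟨i, hi, h⟩ => ⟨i, hi.1, Nat.le_of_lt_succ hi.2, h⟩,
        fun ⟨i, h1, h2, h⟩ => ⟨i, ⟨h1, Nat.lt_succ_of_le h2⟩, h⟩⟩
    rw [h2, rangeBefore_mk, h1]
    by_cases h : mk A ∈ noReturnUpTo n
    · rw [Set.ncard_insert_of_notMem (fun h' => hmem.1 h' h) hfin, Set.indicator_of_mem h]
      push_cast
      simp [add_comm]
    · rw [Set.insert_eq_of_mem (hmem.2 h), Set.indicator_of_notMem h, zero_add]

theorem measurable_rangeBefore (n : ℕ) : Measurable fun a => (rangeBefore n a : ℝ) := by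
  induction n with
  | zero => simp [rangeBefore]
  | succ n ih =>
    simp_rw [rangeBefore_succ]
    exact (measurable_one.indicator (measurableSet_noReturnUpTo n)).add (ih.comp measurable_shift)

theorem isBoundedSubadditive_rangeBefore :
    IsBoundedSubadditive shift 1 fun n a => (rangeBefore n a : ℝ) where
  measurable := measurable_rangeBefore
  nonneg n a := Nat.cast_nonneg _
  le n a := by
    rw [one_mul]
    induction a using ind with
    | h A =>
      rw [rangeBefore_mk]
      exact_mod_cast (Set.ncard_image_le (Set.finite_Iio n)).trans (by simp)
  add_le m n a := by
    induction a using ind with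
    | h A =>
      have h : A.path '' Set.Iio (m + n) =
          A.path '' Set.Iio m ∪ (fun k => A.path (k + m)) '' Set.Iio n := by
        rw [show (fun k => A.path (k + m)) = A.path ∘ (· + m) from rfl, Set.image_comp,
          ← Set.image_union]
        congr 1
        ext i
        simp only [Set.mem_Iio, Set.mem_union, Set.mem_image]
        refine ⟨fun hi => ?_, ?_⟩
        · by_cases him : i < m
          · exact .inl him
          · exact .inr ⟨i - m, by omega, by omega⟩
        · rintro (hi | ⟨j, hj, rfl⟩) <;> omega
      rw [iterate_shift_mk, rangeBefore_mk, rangeBefore_mk, rangeBefore_mk, h]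
      exact_mod_cast Set.ncard_union_le _ _

theorem integral_rangeBefore {μ : Measure PathGraph} [IsProbabilityMeasure μ]
    (hT : MeasurePreserving shift μ μ) (n : ℕ) :
    ∫ a, (rangeBefore n a : ℝ) ∂μ = ∑ k ∈ Finset.range n, μ.real (noReturnUpTo k) := by
  induction n with
  | zero => simp [rangeBefore]
  | succ n ih =>
    have hi := isBoundedSubadditive_rangeBefore.integrable (μ := μ) n
    have h1 : ∫ a, (rangeBefore n (shift a) : ℝ) ∂μ = ∫ a, (rangeBefore n a : ℝ) ∂μ := by
      have h := integral_map (μ := μ) measurable_shift.aemeasurable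
        (measurable_rangeBefore n).aestronglyMeasurable
      rw [hT.map_eq] at h
      exact h.symm
    simp_rw [rangeBefore_succ]
    have h2 : Integrable ((noReturnUpTo n).indicator (1 : PathGraph → ℝ)) μ :=
      (integrable_const (1 : ℝ)).indicator (measurableSet_noReturnUpTo n)
    have h3 : Integrable (fun a => (rangeBefore n (shift a) : ℝ)) μ :=
      (hT.integrable_comp hi.1).2 hi
    rw [integral_add h2 h3, h1, ih, Finset.sum_range_succ,
      integral_indicator_one (measurableSet_noReturnUpTo n), add_comm]

/-- The expected number of visited vertices grows at the rate of the probability of no return. -/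
theorem tendsto_integral_rangeBefore {μ : Measure PathGraph} [IsProbabilityMeasure μ]
    (hT : MeasurePreserving shift μ μ) :
    Tendsto (fun n : ℕ => (∫ a, (rangeBefore n a : ℝ) ∂μ) / n) atTop
      (𝓝 (μ.real neverReturns)) := by
  have h := tendsto_measure_iInter_atTop (μ := μ) (s := noReturnUpTo)
    (fun k => (measurableSet_noReturnUpTo k).nullMeasurableSet) antitone_noReturnUpTo
    ⟨0, measure_ne_top _ _⟩
  rw [iInter_noReturnUpTo] at h
  have h' : Tendsto (fun k => μ.real (noReturnUpTo k)) atTop (𝓝 (μ.real neverReturns)) :=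
    (ENNReal.tendsto_toReal (measure_ne_top μ _)).comp h
  refine h'.cesaro.congr fun n => ?_
  rw [integral_rangeBefore hT, div_eq_inv_mul]

theorem range_div_le (n : ℕ) (a : PathGraph) : |(range n a : ℝ) / n| ≤ 2 := by
  rw [abs_of_nonneg (by positivity)]
  rcases n.eq_zero_or_pos with rfl | hn
  · simp
  · have h := isBoundedSubadditive_rangeBefore.le (n + 1) a
    have hn' : (1 : ℝ) ≤ n := by exact_mod_cast hn
    rw [div_le_iff₀ (by linarith)]
    change (range n a : ℝ) ≤ _ at h
    push_cast at h
    linarith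

theorem dist_div_le (n : ℕ) (a : PathGraph) : |(dist n a : ℝ) / n| ≤ 1 := by
  rw [abs_of_nonneg (by positivity)]
  exact div_le_one_of_le₀ (by exact_mod_cast dist_le n a) n.cast_nonneg

end PathGraph

theorem theorem2p2 (P : Measure RootedGraph) [IsProbabilityMeasure P]
    (hstat : IsStationaryRandomGraph P) (herg : IsErgodicRandomGraph P) :
    ∃ s : ℝ, 0 ≤ s ∧
      ((∀ᵐ a ∂walkLaw P, Tendsto (fun n : ℕ => (PathGraph.range n a : ℝ) / n) atTop
          (𝓝 ((walkLaw P).real PathGraph.neverReturns))) ∧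
        (∀ n : ℕ, MemLp (fun a => (PathGraph.range n a : ℝ) / n) 1 (walkLaw P)) ∧
        Tendsto (fun n : ℕ => eLpNorm (fun a => (PathGraph.range n a : ℝ) / n -
          (walkLaw P).real PathGraph.neverReturns) 1 (walkLaw P)) atTop (𝓝 0)) ∧
      ((∀ᵐ a ∂walkLaw P, Tendsto (fun n : ℕ => (PathGraph.dist n a : ℝ) / n) atTop (𝓝 s)) ∧
        (∀ n : ℕ, MemLp (fun a => (PathGraph.dist n a : ℝ) / n) 1 (walkLaw P)) ∧
        Tendsto (fun n : ℕ => eLpNorm (fun a => (PathGraph.dist n a : ℝ) / n - s) 1 (walkLaw P))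
          atTop (𝓝 0)) := by
  have hT : Ergodic PathGraph.shift (walkLaw P) := ⟨hstat.measurePreserving_shift, herg⟩
  obtain ⟨s, hs, -, hD⟩ := PathGraph.isBoundedSubadditive_dist.exists_ae_tendsto hT
  obtain ⟨γ, -, hγ, hR⟩ := PathGraph.isBoundedSubadditive_rangeBefore.exists_ae_tendsto hT
  obtain rfl := tendsto_nhds_unique hγ
    (PathGraph.tendsto_integral_rangeBefore hT.toMeasurePreserving)
  have hRm : ∀ n : ℕ, Measurable fun a => (PathGraph.range n a : ℝ) / n := fun n =>
    (PathGraph.measurable_rangeBefore (n + 1)).div_const _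
  have hDm : ∀ n : ℕ, Measurable fun a => (PathGraph.dist n a : ℝ) / n := fun n =>
    (PathGraph.isBoundedSubadditive_dist.measurable n).div_const _
  have hR' : ∀ᵐ a ∂walkLaw P, Tendsto (fun n : ℕ => (PathGraph.range n a : ℝ) / n) atTop
      (𝓝 ((walkLaw P).real PathGraph.neverReturns)) := by
    filter_upwards [hR] with a ha
    have h1 : Tendsto (fun n : ℕ => ((n + 1 : ℕ) : ℝ) / n) atTop (𝓝 1) := by
      have := (tendsto_natCast_div_add_atTop (1 : ℝ)).inv₀ one_ne_zero
      simpa using this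
    have h2 := (ha.comp (tendsto_add_atTop_nat 1)).mul h1
    rw [mul_one] at h2
    refine h2.congr fun n => ?_
    exact div_mul_div_cancel₀ (by positivity)
  exact ⟨s, hs,
    ⟨hR', fun n => .of_bound (hRm n).aestronglyMeasurable 2
      (ae_of_all _ (PathGraph.range_div_le n)),
      tendsto_eLpNorm_one_of_bounded hRm PathGraph.range_div_le hR'⟩,
    ⟨hD, fun n => .of_bound (hDm n).aestronglyMeasurable 1
      (ae_of_all _ (PathGraph.dist_div_le n)),
      tendsto_eLpNorm_one_of_bounded hDm PathGraph.dist_div_le hD⟩⟩
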